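/- **Filtered Reduction Theorem.** Let $\Gamma$ be a resolution graph of a normal surface singularity whose link is a rational homology sphere, i.e. a finite tree with vertex set $\mathcal V$, decorated by integers $e_v$, such that the intersection form on $L=\bigoplus_{v\in\mathcal V}\mathbb Z E_v$ given by $(E_v,E_v)=e_v$ and, for $v\neq w$, $(E_v,E_w)=1$ if $v,w$ are adjacent and $0$ otherwise, is negative definite. Let $L'=\{l'\in L\otimes\mathbb Q:(l',L)\subset\mathbb Z\}$, $H=L'/L$, and $\mathcal S'=\{l'\in L':(l',E_v)\le 0\ \forall v\in\mathcal V\}$. Order $L\otimes \mathbb Q$ coefficientwise. Let $Z_K\in L'$ be determined by $(Z_K,E_v)=(E_v,E_v)+2$ for all $v$. Fix $h\in H$, let $s_h$ be the least element of $\mathcal S'$ with class $h$, and put $\chi_h(l)=-\tfrac12(l,\,l-Z_K+2s_h)\in\mathbb Z$ for $l\in L$. Let $\overline{\mathcal V}\subset\mathcal V$ be an SR-set: replacing the numbers $e_i$, $i\in\overline{\mathcal V}$, by suitable integers $e_i'\le e_i$ one gets a rational graph (a graph as above with $\chi_0(l)\ge 1$ for all $l\in L$, $l>0$). Let $\overline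 L=\bigoplus_{i\in\overline{\mathcal V}}\mathbb Z E_i\subset L$. For $\bar l=\sum_{i\in\overline{\mathcal V}} l_iE_i\in\overline L$, $\bar l\ge 0$, let $x_h(\bar l)$ be the least $x\in L$ whose $E_i$-coefficient is $l_i$ for every $i\in\overline{\mathcal V}$ and with $(x+s_h,E_v)\le 0$ for every $v\notin\overline{\mathcal V}$; put $\overline\chi_h(\bar l)=\chi_h(x_h(\bar l))$. For $l\in\mathbb Z^{\mathcal V}$ and $I\subset\mathcal V$ let $(l,I)\subset\mathbb R^{\mathcal V}$ be the cube with vertices $l+\sum_{i\in J}E_i$, $J\subset I$, and let its weight $w_h(l,I)$ be the maximum of $\chi_h$ on its vertices. For $n\in\mathbb Z$ let $S_n(w_h)\subset(\mathbb R_{\ge0})^{\mathcal V}$ be the union of the cubes $(l,I)$ with $l\ge0$ and $w_h(l,I)\le n$. Define $S_n(\overline w_h)\subset(\mathbb R_{\ge0})^{\overline{\mathcal V}}$ in the same way from $\overline{\mathcal V}$ and $\overline\chi_h$. Let $s_1,\dots,s_t\in\mathcal S'\setminus\{0\}$ have $E^*$-support in $\overline{\mathcal V}$, i.e. $(s_j,E_v)=0$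 for all $v\notin\overline{\mathcal V}$ and all $j$. For $d=(d_1,\dots,d_t)\in\mathbb Z^t$ let $\mathfrak X_{-d}\subset(\mathbb R_{\ge0})^{\mathcal V}$ be the union of the cubes $(l,I)$ with $l\ge0$ and $(s_j,l)\le -d_j$ for all $j$, and let $\overline{\mathfrak X}_{-d}\subset(\mathbb R_{\ge0})^{\overline{\mathcal V}}$ be the union of the cubes $(\bar l,I)$, $I\subset\overline{\mathcal V}$, with $\bar l\in\overline L$, $\bar l\ge0$ and $(s_j,\bar l)\le-d_j$ for all $j$. Then for all $n\in\mathbb Z$ and $d\in\mathbb Z^t$ the projection $pr:\mathbb R^{\mathcal V}\to\mathbb R^{\overline{\mathcal V}}$, $\sum_{v\in\mathcal V}l_vE_v\mapsto\sum_{i\in\overline{\mathcal V}}l_iE_i$, maps $S_n(w_h)\cap\mathfrak X_{-d}$ into $S_n(\overline w_h)\cap\overline{\mathfrak X}_{-d}$, and the induced map $$pr:\ S_n(w_h)\cap\mathfrak X_{-d}\longrightarrow S_n(\overline w_h)\cap\overline{\mathfrak X}_{-d}$$ is a homotopy equivalence. The same holds if $\mathfrak X_{-d}$ and $\overline{\mathfrak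 X}_{-d}$ are replaced by $\{x\in(\mathbb R_{\ge0})^{\mathcal V}:(s_j,x)\le-d_j\ \forall j\}$ and $\{\bar x\in(\mathbb R_{\ge0})^{\overline{\mathcal V}}:(s_j,\bar x)\le-d_j\ \forall j\}$. -/

import Mathlib

/-! Resolution graphs, their lattices, and the weighted cubical spaces attached to them. -/

/-- The intersection matrix of a decorated graph: `(E_v, E_v) = euler v`, and for `v ≠ w`
`(E_v, E_w)` is `1` or `0` according to whether `v, w` are joined by an edge. -/
noncomputable def interMatrix {V : Type*} [DecidableEq V] (G : SimpleGraph V) (euler : V → ℤ)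
    (v w : V) : ℤ :=
  open Classical in if v = w then euler v else if G.Adj v w then 1 else 0

/-- A resolution graph of a normal surface singularity with rational homology sphere link
(equivalently, a connected negative definite plumbing tree of rational curves): a finite tree,
decorated with Euler numbers (self-intersections), whose intersection form on `ℤ^V` is
negative definite. -/
structure ResolutionGraph (V : Type*) [Fintype V] [DecidableEq V] where
  graph : SimpleGraph V
  euler : V → ℤ
  isTree : graph.IsTree
  negDef : ∀ x : V → ℤ, x ≠ 0 → ∑ v, ∑ w, x v * interMatrix graph euler v w * x w < 0

namespace ResolutionGraph

variable {V : Type*} [Fintype V] [DecidableEq V] (Γ : ResolutionGraph V)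

/-- The intersection form `(x, y)` on `L ⊗ R = R^V` (`R` is one of `ℤ`, `ℚ`, `ℝ`). -/
noncomputable def form (R : Type*) [CommRing R] (x y : V → R) : R :=
  ∑ v, ∑ w, x v * (interMatrix Γ.graph Γ.euler v w : R) * y w

/-- An element of the lattice `L = ℤ^V`, seen in `L ⊗ ℚ`. -/
def toRat (l : V → ℤ) : V → ℚ := fun v => (l v : ℚ)

/-- The base element `E_v`, seen in `L ⊗ ℚ`. -/
def E (v : V) : V → ℚ := Pi.single v 1

/-- The lattice `L`, as a subgroup of `L ⊗ ℚ`. -/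
def lattice (V : Type*) : AddSubgroup (V → ℚ) where
  carrier := {r | ∃ l : V → ℤ, toRat l = r}
  zero_mem' := ⟨0, by ext; simp [toRat]⟩
  add_mem' := by
    rintro _ _ ⟨a, rfl⟩ ⟨b, rfl⟩
    exact ⟨a + b, by ext; simp [toRat]⟩
  neg_mem' := by
    rintro _ ⟨a, rfl⟩
    exact ⟨-a, by ext; simp [toRat]⟩

lemma form_add_left (R : Type*) [CommRing R] (x y z : V → R) :
    Γ.form R (x + y) z = Γ.form R x z + Γ.form R y z := by
  simp [form, add_mul, Finset.sum_add_distrib]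

lemma form_smul_left (R : Type*) [CommRing R] (c : R) (x z : V → R) :
    Γ.form R (c • x) z = c * Γ.form R x z := by
  simp [form, Finset.mul_sum, mul_assoc]

lemma form_neg_left (R : Type*) [CommRing R] (x z : V → R) :
    Γ.form R (-x) z = - Γ.form R x z := by
  simp [form]

lemma interMatrix_symm (v w : V) :
    interMatrix Γ.graph Γ.euler v w = interMatrix Γ.graph Γ.euler w v := by
  by_cases h : v = w
  · subst h; rfl
  · by_cases hA : Γ.graph.Adj v w
    · simp [interMatrix, h, Ne.symm h, hA, hA.symm]
    · have hA' : ¬ Γ.graph.Adj w v := fun h1 => hA h1.symm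
      simp [interMatrix, h, Ne.symm h, hA, hA']

lemma interMatrix_nonneg {v w : V} (h : v ≠ w) : 0 ≤ interMatrix Γ.graph Γ.euler v w := by
  simp only [interMatrix, if_neg h]
  split_ifs <;> norm_num

lemma form_comm (R : Type*) [CommRing R] (x y : V → R) : Γ.form R x y = Γ.form R y x := by
  unfold form
  rw [Finset.sum_comm]
  refine Finset.sum_congr rfl fun v _ => Finset.sum_congr rfl fun w _ => ?_
  rw [Γ.interMatrix_symm]
  ring

lemma form_E (x : V → ℚ) (v : V) :
    Γ.form ℚ x (E v) = ∑ w, x w * (interMatrix Γ.graph Γ.euler w v : ℚ) := by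
  simp [form, E, Pi.single_apply]

lemma form_eq_sum (x y : V → ℚ) : Γ.form ℚ x y = ∑ v, Γ.form ℚ x (E v) * y v := by
  simp only [form_E, Finset.sum_mul]
  unfold form
  exact Finset.sum_comm

/-- The dual lattice `L' = {l' ∈ L ⊗ ℚ : (l', L) ⊆ ℤ}`. -/
def dualLattice : AddSubgroup (V → ℚ) where
  carrier := {r | ∀ l : V → ℤ, ∃ m : ℤ, Γ.form ℚ r (toRat l) = m}
  zero_mem' := fun l => ⟨0, by simp [form]⟩
  add_mem' := by
    intro a b ha hb l
    obtain ⟨m, hm⟩ := ha l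
    obtain ⟨k, hk⟩ := hb l
    exact ⟨m + k, by rw [form_add_left, hm, hk]; push_cast; rfl⟩
  neg_mem' := by
    intro a ha l
    obtain ⟨m, hm⟩ := ha l
    exact ⟨-m, by rw [form_neg_left, hm]; push_cast; rfl⟩

/-- The group `H = L' / L` (isomorphic to the first homology of the link). -/
abbrev discGroup : Type _ := Γ.dualLattice ⧸ (lattice V).addSubgroupOf Γ.dualLattice

/-- `r` lies in `L'` and its class in `H` is `h`. -/
def HasClass (r : V → ℚ) (h : Γ.discGroup) : Prop :=
  ∃ hr : r ∈ Γ.dualLattice, (QuotientAddGroup.mk ⟨r, hr⟩ : Γ.discGroup) = h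

/-- The Lipman cone `S' = {l' ∈ L' : (l', E_v) ≤ 0 for all v}`. -/
def lipmanCone : Set (V → ℚ) := {r | r ∈ Γ.dualLattice ∧ ∀ v, Γ.form ℚ r (E v) ≤ 0}

/-- The `E*`-support of `s`: the vertices `v` with `(s, E_v) < 0`. -/
def supp (s : V → ℚ) : Set V := {v | Γ.form ℚ s (E v) < 0}

/-! Helper facts: consequences of negative definiteness. -/

lemma form_self_neg (x : V → ℚ) (hx : x ≠ 0) : Γ.form ℚ x x < 0 := by
  -- clear denominators
  let N : ℕ := ∏ v, (x v).den
  have hN : 0 < N := Finset.prod_pos fun v _ => (x v).den_pos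
  have hint : ∀ v, ∃ m : ℤ, (m : ℚ) = N * x v := by
    intro v
    obtain ⟨k, hk⟩ : (x v).den ∣ N := Finset.dvd_prod_of_mem _ (Finset.mem_univ v)
    refine ⟨k * (x v).num, ?_⟩
    rw [hk]
    push_cast
    rw [mul_comm ((x v).den : ℚ), mul_assoc, mul_comm ((x v).den : ℚ), Rat.mul_den_eq_num]
  choose y hy using hint
  have hNQ : (0 : ℚ) < N := by exact_mod_cast hN
  have hy0 : y ≠ 0 := by
    rintro rfl
    apply hx
    ext v
    have := hy v
    simp only [Pi.zero_apply, Int.cast_zero] at this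
    rcases mul_eq_zero.1 this.symm with h | h
    · exact absurd h hNQ.ne'
    · exact h
  have h1 := Γ.negDef y hy0
  have h2 : ((∑ v, ∑ w, y v * interMatrix Γ.graph Γ.euler v w * y w : ℤ) : ℚ)
      = (N : ℚ) ^ 2 * Γ.form ℚ x x := by
    push_cast
    simp only [hy, form, Finset.mul_sum]
    refine Finset.sum_congr rfl fun v _ => Finset.sum_congr rfl fun w _ => ?_
    ring
  have h3 : (N : ℚ) ^ 2 * Γ.form ℚ x x < 0 := by
    rw [← h2]; exact_mod_cast h1
  by_contra hcon
  push Not at hcon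
  exact absurd h3 (not_lt.2 (mul_nonneg (by positivity) hcon))

/-- The intersection form is nondegenerate: any values `(r, E_v)` can be prescribed. -/
lemma exists_form_E_eq (c : V → ℚ) : ∃ r : V → ℚ, ∀ v, Γ.form ℚ r (E v) = c v := by
  let T : (V → ℚ) →ₗ[ℚ] (V → ℚ) :=
    { toFun := fun r v => Γ.form ℚ r (E v)
      map_add' := fun a b => by ext v; simp [form_add_left]
      map_smul' := fun a b => by ext v; simp [form_smul_left] }
  have hT : Function.Injective T := by
    rw [injective_iff_map_eq_zero]
    intro r hr
    by_contra h0
    have h1 := Γ.form_self_neg r h0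
    rw [form_eq_sum] at h1
    have h2 : ∀ v, Γ.form ℚ r (E v) = 0 := fun v => congrFun hr v
    simp [h2] at h1
  obtain ⟨r, hr⟩ := (LinearMap.injective_iff_surjective.1 hT) c
  exact ⟨r, fun v => congrFun hr v⟩

/-- The anticanonical cycle `Z_K`, determined by the adjunction formulae. -/
noncomputable def ZK : V → ℚ := (Γ.exists_form_E_eq fun v => (Γ.euler v : ℚ) + 2).choose

/-- The adjunction formulae `(Z_K, E_v) = (E_v, E_v) + 2`. -/
lemma form_ZK (v : V) : Γ.form ℚ Γ.ZK (E v) = Γ.form ℚ (E v) (E v) + 2 := by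
  have h1 := (Γ.exists_form_E_eq fun v => (Γ.euler v : ℚ) + 2).choose_spec v
  have h2 : Γ.form ℚ (E v) (E v) = Γ.euler v := by
    rw [form_E, Finset.sum_eq_single v]
    · simp [E, interMatrix]
    · intro w _ hw
      simp [E, hw]
    · simp
  rw [h2]
  exact h1

lemma nonneg_of_form_nonpos (W : Finset V) (r : V → ℚ) (h1 : ∀ v ∈ W, Γ.form ℚ r (E v) ≤ 0)
    (h2 : ∀ v ∉ W, 0 ≤ r v) : 0 ≤ r := by
  let p : V → ℚ := fun v => max (r v) 0
  let q : V → ℚ := fun v => max (-r v) 0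
  have hr : r = p + -q := by
    ext v
    simp only [p, q, Pi.add_apply, Pi.neg_apply]
    rcases le_total (r v) 0 with h | h
    · rw [max_eq_right h, max_eq_left (by linarith)]; ring
    · rw [max_eq_left h, max_eq_right (by linarith)]; ring
  have hq0 : ∀ v ∉ W, q v = 0 := fun v hv => max_eq_right (by linarith [h2 v hv])
  have hqn : ∀ v, 0 ≤ q v := fun v => le_max_right _ _
  have hpn : ∀ v, 0 ≤ p v := fun v => le_max_right _ _
  have hrq : Γ.form ℚ r q ≤ 0 := by
    rw [form_eq_sum]
    refine Finset.sum_nonpos fun v _ => ?_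
    by_cases hv : v ∈ W
    · exact mul_nonpos_of_nonpos_of_nonneg (h1 v hv) (hqn v)
    · simp [hq0 v hv]
  have hpq : 0 ≤ Γ.form ℚ p q := by
    refine Finset.sum_nonneg fun v _ => Finset.sum_nonneg fun w _ => ?_
    by_cases hvw : v = w
    · subst hvw
      have : p v * q v = 0 := by
        simp only [p, q]
        rcases le_total (r v) 0 with h | h
        · rw [max_eq_right h]; ring
        · rw [max_eq_right (a := -r v) (by linarith)]; ring
      rw [mul_right_comm, this]; simp
    · have : (0 : ℚ) ≤ interMatrix Γ.graph Γ.euler v w := by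
        exact_mod_cast Γ.interMatrix_nonneg hvw
      exact mul_nonneg (mul_nonneg (hpn v) this) (hqn w)
  have hq : q = 0 := by
    by_contra hne
    have h3 := Γ.form_self_neg q hne
    have h4 : Γ.form ℚ r q = Γ.form ℚ p q - Γ.form ℚ q q := by
      conv_lhs => rw [hr, form_add_left, form_neg_left]
      ring
    linarith
  rw [hr, hq]
  intro v
  simpa using hpn v

/-- There is a strictly positive integral cycle `u` with `(u, E_v) ≤ -1` for all `v`. -/
lemma exists_ample : ∃ u : V → ℤ, (∀ v, 1 ≤ u v) ∧ ∀ v, Γ.form ℚ (toRat u) (E v) ≤ -1 := by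
  obtain ⟨x, hx⟩ := Γ.exists_form_E_eq fun _ => -1
  let N : ℕ := ∏ v, (x v).den
  have hN : 0 < N := Finset.prod_pos fun v _ => (x v).den_pos
  have hint : ∀ v, ∃ m : ℤ, (m : ℚ) = N * x v := by
    intro v
    obtain ⟨k, hk⟩ : (x v).den ∣ N := Finset.dvd_prod_of_mem _ (Finset.mem_univ v)
    refine ⟨k * (x v).num, ?_⟩
    rw [hk]
    push_cast
    rw [mul_comm ((x v).den : ℚ), mul_assoc, mul_comm ((x v).den : ℚ), Rat.mul_den_eq_num]
  choose u hu using hint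
  have hN1 : (1 : ℚ) ≤ N := by exact_mod_cast hN
  have hform : ∀ v, Γ.form ℚ (toRat u) (E v) ≤ -1 := by
    intro v
    have : toRat u = (N : ℚ) • x := by ext w; simp [toRat, hu]
    rw [this, form_smul_left, hx]
    linarith
  have hnn : 0 ≤ toRat u := Γ.nonneg_of_form_nonpos Finset.univ _
    (fun v _ => by linarith [hform v]) (fun v hv => absurd (Finset.mem_univ v) hv)
  refine ⟨u, fun v => ?_, hform⟩
  by_contra hlt
  have h0 : u v = 0 := by
    have : (0 : ℚ) ≤ u v := hnn v
    have : 0 ≤ u v := by exact_mod_cast this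
    omega
  have h1 := hform v
  have h2 : 0 ≤ Γ.form ℚ (toRat u) (E v) := by
    rw [form_E]
    refine Finset.sum_nonneg fun w _ => ?_
    by_cases hwv : w = v
    · subst hwv; simp [toRat, h0]
    · exact mul_nonneg (hnn w) (by exact_mod_cast Γ.interMatrix_nonneg hwv)
  linarith

/-- For `r ∈ L ⊗ ℚ` and a set `W` of vertices there is a least integral cycle `m` supported in `W`
such that `(r + m, E_v) ≤ 0` for all `v ∈ W`. -/
lemma exists_isLeast (W : Finset V) (r : V → ℚ) :
    ∃ m, IsLeast {m : V → ℤ | (∀ v ∉ W, m v = 0) ∧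
      ∀ v ∈ W, Γ.form ℚ (r + toRat m) (E v) ≤ 0} m := by
  set Q : Set (V → ℤ) := {m | (∀ v ∉ W, m v = 0) ∧
      ∀ v ∈ W, Γ.form ℚ (r + toRat m) (E v) ≤ 0} with hQ
  obtain ⟨u, hu1, hu2⟩ := Γ.exists_ample
  -- a common bound
  obtain ⟨N, hN⟩ : ∃ N : ℕ, ∀ v, |r v| ≤ N ∧ |Γ.form ℚ r (E v)| ≤ N := by
    obtain ⟨N, hN⟩ := exists_nat_ge (∑ v, (|r v| + |Γ.form ℚ r (E v)|))
    refine ⟨N, fun v => ?_⟩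
    have := Finset.single_le_sum (f := fun v => |r v| + |Γ.form ℚ r (E v)|)
      (fun w _ => by positivity) (Finset.mem_univ v)
    constructor <;> linarith [abs_nonneg (r v), abs_nonneg (Γ.form ℚ r (E v))]
  have hN0 : (0 : ℚ) ≤ N := by positivity
  have huQ : ∀ v, (1 : ℚ) ≤ u v := fun v => by exact_mod_cast hu1 v
  -- nonempty
  have hne : (fun v => if v ∈ W then (N : ℤ) * u v else 0) ∈ Q := by
    refine ⟨fun v hv => by simp [hv], fun v hv => ?_⟩
    rw [form_add_left]
    have h1 : Γ.form ℚ (toRat fun v => if v ∈ W then (N : ℤ) * u v else 0) (E v)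
        ≤ N * Γ.form ℚ (toRat u) (E v) := by
      rw [form_E, form_E, Finset.mul_sum]
      refine Finset.sum_le_sum fun w _ => ?_
      by_cases hw : w ∈ W
      · simp [toRat, hw, mul_assoc]
      · have hwv : w ≠ v := fun h => hw (h ▸ hv)
        simp only [toRat, hw, if_false, Int.cast_zero, zero_mul]
        refine mul_nonneg hN0 (mul_nonneg (by linarith [huQ w]) ?_)
        exact_mod_cast Γ.interMatrix_nonneg hwv
    have h2 := (abs_le.1 (hN v).2).2
    have h3 := mul_le_mul_of_nonneg_left (hu2 v) hN0
    linarith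
  -- bounded below
  have hbdd : ∀ m ∈ Q, ∀ v, -(N : ℤ) * u v - N ≤ m v := by
    intro m hm v
    have h1 : 0 ≤ r + toRat m + (N : ℚ) • toRat u := by
      refine Γ.nonneg_of_form_nonpos W _ (fun v hv => ?_) (fun v hv => ?_)
      · rw [form_add_left, form_smul_left]
        have := hm.2 v hv
        have h3 := mul_le_mul_of_nonneg_left (hu2 v) hN0
        linarith
      · have h2 := (abs_le.1 (hN v).1).1
        have h3 := mul_le_mul_of_nonneg_left (huQ v) hN0
        simp only [Pi.add_apply, Pi.smul_apply, smul_eq_mul, toRat, hm.1 v hv]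
        push_cast
        linarith
    have h2 := h1 v
    simp only [Pi.zero_apply, Pi.add_apply, Pi.smul_apply, smul_eq_mul, toRat] at h2
    have h3 := (abs_le.1 (hN v).1).2
    have : (-(N : ℚ) * u v - N) ≤ m v := by linarith
    exact_mod_cast this
  -- closed under minimum
  have hmin : ∀ m ∈ Q, ∀ m' ∈ Q, m ⊓ m' ∈ Q := by
    have key : ∀ m ∈ Q, ∀ m' : V → ℤ, ∀ v ∈ W, m v ≤ m' v →
        Γ.form ℚ (r + toRat (m ⊓ m')) (E v) ≤ 0 := by
      intro m hm m' v hv hle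
      refine le_trans ?_ (hm.2 v hv)
      rw [form_E, form_E]
      refine Finset.sum_le_sum fun w _ => ?_
      by_cases hwv : w = v
      · subst hwv
        simp [toRat, hle]
      · refine mul_le_mul_of_nonneg_right ?_ (by exact_mod_cast Γ.interMatrix_nonneg hwv)
        have : (m ⊓ m') w ≤ m w := inf_le_left
        have : (((m ⊓ m') w : ℤ) : ℚ) ≤ m w := by exact_mod_cast this
        simp only [toRat, Pi.add_apply]
        linarith
    intro m hm m' hm'
    refine ⟨fun v hv => by simp [hm.1 v hv, hm'.1 v hv], fun v hv => ?_⟩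
    rcases le_total (m v) (m' v) with h | h
    · exact key m hm m' v hv h
    · rw [inf_comm]; exact key m' hm' m v hv h
  -- minimize the sum of the coordinates
  obtain ⟨σ, ⟨m, hm, hσ⟩, hleast⟩ := Int.exists_least_of_bdd
    (P := fun k => ∃ m ∈ Q, ∑ v, m v = k)
    ⟨∑ v, (-(N : ℤ) * u v - N), by
      rintro _ ⟨m, hm, rfl⟩
      exact Finset.sum_le_sum fun v _ => hbdd m hm v⟩
    ⟨_, _, hne, rfl⟩
  refine ⟨m, hm, fun m' hm' => ?_⟩
  have h1 := hleast _ ⟨m ⊓ m', hmin m hm m' hm', rfl⟩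
  have h2 : ∀ v ∈ Finset.univ, (m ⊓ m') v ≤ m v := fun v _ => inf_le_left
  have h3 : ∑ v, (m ⊓ m') v = ∑ v, m v :=
    le_antisymm (Finset.sum_le_sum h2) (by rw [hσ]; exact h1)
  have h4 := (Finset.sum_eq_sum_iff_of_le h2).1 h3
  intro v
  have h5 := h4 v (Finset.mem_univ v)
  rw [← h5]
  exact inf_le_right

/-! The weight function. -/

lemma toRat_mem_dualLattice (l : V → ℤ) : toRat l ∈ Γ.dualLattice := by
  intro k
  refine ⟨∑ v, ∑ w, l v * interMatrix Γ.graph Γ.euler v w * k w, ?_⟩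
  simp [form, toRat]

lemma exists_sh (h : Γ.discGroup) :
    ∃ r, IsLeast {r : V → ℚ | r ∈ Γ.lipmanCone ∧ Γ.HasClass r h} r := by
  obtain ⟨⟨r₀, hr₀⟩, rfl⟩ := QuotientAddGroup.mk_surjective h
  obtain ⟨m, hm, hleast⟩ := Γ.exists_isLeast Finset.univ r₀
  have hmem : r₀ + toRat m ∈ Γ.dualLattice :=
    Γ.dualLattice.add_mem hr₀ (Γ.toRat_mem_dualLattice m)
  refine ⟨r₀ + toRat m, ⟨⟨hmem, fun v => hm.2 v (Finset.mem_univ v)⟩, hmem, ?_⟩, ?_⟩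
  · rw [QuotientAddGroup.eq, AddSubgroup.mem_addSubgroupOf]
    exact ⟨-m, by ext v; simp [toRat]⟩
  · rintro r ⟨⟨_, hr2⟩, hr3, hr4⟩
    rw [eq_comm, QuotientAddGroup.eq, AddSubgroup.mem_addSubgroupOf] at hr4
    obtain ⟨k, hk⟩ := hr4
    have hk' : r = r₀ + toRat k := by
      rw [hk]; ext v; simp
    have : m ≤ k := hleast ⟨fun v hv => absurd (Finset.mem_univ v) hv, fun v _ => by
      rw [← hk']; exact hr2 v⟩
    rw [hk']
    intro v
    have h1 : ((m v : ℤ) : ℚ) ≤ k v := by exact_mod_cast this v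
    simp only [toRat, Pi.add_apply]
    linarith

/-- `s_h`: the least element of the Lipman cone with class `h`. -/
noncomputable def sh (h : Γ.discGroup) : V → ℚ := (Γ.exists_sh h).choose

lemma isLeast_sh (h : Γ.discGroup) :
    IsLeast {r : V → ℚ | r ∈ Γ.lipmanCone ∧ Γ.HasClass r h} (Γ.sh h) :=
  (Γ.exists_sh h).choose_spec

/-- The weight function `χ_h(l) = -(l, l + k_h)/2`, where `k_h = -Z_K + 2 s_h`
(its values are integers). -/
noncomputable def chi (h : Γ.discGroup) (l : V → ℤ) : ℚ :=
  -(Γ.form ℚ (toRat l) (toRat l + (-Γ.ZK + (2 : ℚ) • Γ.sh h))) / 2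

/-- A rational graph (Artin's criterion): `χ(l) ≥ 1` for every `l ∈ L`, `l > 0`. -/
def IsRational : Prop := ∀ l : V → ℤ, 0 < l → 1 ≤ Γ.chi 0 l

/-- `B` is an SR-set (a set of bad vertices): decreasing the Euler numbers of the vertices in `B`
one can reach a rational graph. -/
def IsSRSet (B : Finset V) : Prop :=
  ∃ Γ' : ResolutionGraph V, Γ'.graph = Γ.graph ∧ (∀ v ∉ B, Γ'.euler v = Γ.euler v) ∧
    (∀ v ∈ B, Γ'.euler v ≤ Γ.euler v) ∧ Γ'.IsRational

/-- The inclusion `∑_{i ∈ B} l_i E_i` of the reduced lattice (or of its real version). -/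
def extendZero {R : Type*} [Zero R] (B : Finset V) (l : B → R) : V → R :=
  fun v => if hv : v ∈ B then l ⟨v, hv⟩ else 0

/-- The defining set of the universal cycle `x_h(l)`, `l` in the reduced lattice: the `x ∈ L` with
`E_i`-coefficients `l_i` for `i ∈ B`, and with `(x + s_h, E_v) ≤ 0` for `v ∉ B`. -/
def xhSet (B : Finset V) (h : Γ.discGroup) (l : B → ℤ) : Set (V → ℤ) :=
  {x | (∀ i : B, x i = l i) ∧ ∀ v ∉ B, Γ.form ℚ (toRat x + Γ.sh h) (E v) ≤ 0}

lemma exists_xh (B : Finset V) (h : Γ.discGroup) (l : B → ℤ) :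
    ∃ x, IsLeast (Γ.xhSet B h l) x := by
  obtain ⟨m, hm, hleast⟩ := Γ.exists_isLeast Bᶜ (toRat (extendZero B l) + Γ.sh h)
  have hcast : ∀ k : V → ℤ, toRat (extendZero B l + k) + Γ.sh h
      = toRat (extendZero B l) + Γ.sh h + toRat k := by
    intro k; ext v; simp [toRat]; ring
  refine ⟨extendZero B l + m, ⟨fun i => ?_, fun v hv => ?_⟩, ?_⟩
  · simp [extendZero, hm.1 i (by simp)]
  · rw [hcast]; exact hm.2 v (by simpa using hv)
  · rintro x ⟨hx1, hx2⟩
    have h1 : x = extendZero B l + (x - extendZero B l) := by abel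
    have h2 : m ≤ x - extendZero B l := by
      refine hleast ⟨fun v hv => ?_, fun v hv => ?_⟩
      · have hv' : v ∈ B := by simpa using hv
        simp [extendZero, hv', ← hx1 ⟨v, hv'⟩]
      · rw [← hcast, ← h1]; exact hx2 v (by simpa using hv)
    rw [h1]
    exact add_le_add le_rfl h2

/-- The universal cycle `x_h(l)`: the least element of its defining set. -/
noncomputable def xh (B : Finset V) (h : Γ.discGroup) (l : B → ℤ) : V → ℤ :=
  (Γ.exists_xh B h l).choose

lemma isLeast_xh (B : Finset V) (h : Γ.discGroup) (l : B → ℤ) :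
    IsLeast (Γ.xhSet B h l) (Γ.xh B h l) :=
  (Γ.exists_xh B h l).choose_spec

/-- The reduced weight function `l ↦ χ_h(x_h(l))`. -/
noncomputable def chiRed (B : Finset V) (h : Γ.discGroup) (l : B → ℤ) : ℚ :=
  Γ.chi h (Γ.xh B h l)

end ResolutionGraph

/-! Cubical spaces in the first quadrant of `ℝ^ι`. -/

section Cubes

variable {ι : Type*} [Fintype ι] [DecidableEq ι]

/-- `E_J = ∑_{i ∈ J} E_i`. -/
def sumE (J : Finset ι) : ι → ℤ := fun i => if i ∈ J then 1 else 0

/-- The cube `(l, I)`, whose vertices are the points `l + E_J`, `J ⊆ I`. -/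
def cube (l : ι → ℤ) (I : Finset ι) : Set (ι → ℝ) :=
  {x | ∀ i, (l i : ℝ) ≤ x i ∧ x i ≤ ((l + sumE I) i : ℤ)}

/-- The weight of a cube: the maximum of the weights of its vertices. -/
def cubeWeight (w : (ι → ℤ) → ℚ) (l : ι → ℤ) (I : Finset ι) : ℚ :=
  I.powerset.sup' (Finset.powerset_nonempty I) fun J => w (l + sumE J)

/-- `S_n(w)`: the union of all cubes of the first quadrant of weight at most `n`. -/
def sublevel (w : (ι → ℤ) → ℚ) (n : ℤ) : Set (ι → ℝ) :=
  {x | ∃ (l : ι → ℤ) (I : Finset ι), 0 ≤ l ∧ cubeWeight w l I ≤ n ∧ x ∈ cube l I}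

end Cubes

namespace ResolutionGraph

variable {V : Type*} [Fintype V] [DecidableEq V] (Γ : ResolutionGraph V)

/-- The cubical subspace `𝔛_{-d}`: the union of the cubes `(l, I)` with `l ∈ (ℤ_{≥ 0})^V` and
`(s_j, l) ≤ -d_j` for all `j`. -/
def filt {t : ℕ} (s : Fin t → V → ℚ) (d : Fin t → ℤ) : Set (V → ℝ) :=
  {x | ∃ (l : V → ℤ) (I : Finset V), 0 ≤ l ∧ (∀ j, Γ.form ℚ (s j) (toRat l) ≤ -d j) ∧
    x ∈ cube l I}

/-- The corresponding subspace for the reduced lattice: the union of the cubes `(l, I)` of the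
reduced first quadrant with `(s_j, l) ≤ -d_j` for all `j`. -/
def filtRed (B : Finset V) {t : ℕ} (s : Fin t → V → ℚ) (d : Fin t → ℤ) : Set (B → ℝ) :=
  {x | ∃ (l : B → ℤ) (I : Finset B), 0 ≤ l ∧
    (∀ j, Γ.form ℚ (s j) (toRat (extendZero B l)) ≤ -d j) ∧ x ∈ cube l I}

/-- The polyhedral version `{x ∈ (ℝ_{≥ 0})^V : (s_j, x) ≤ -d_j for all j}` of `𝔛_{-d}`. -/
def halfFilt {t : ℕ} (s : Fin t → V → ℚ) (d : Fin t → ℤ) : Set (V → ℝ) :=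
  {x | 0 ≤ x ∧ ∀ j, Γ.form ℝ (fun v => (s j v : ℝ)) x ≤ -d j}

/-- The polyhedral version for the reduced lattice. -/
def halfFiltRed (B : Finset V) {t : ℕ} (s : Fin t → V → ℚ) (d : Fin t → ℤ) : Set (B → ℝ) :=
  {x | 0 ≤ x ∧ ∀ j, Γ.form ℝ (fun v => (s j v : ℝ)) (extendZero B x) ≤ -d j}

/-- The projection `ℝ^V → ℝ^B`, `∑_{v ∈ V} l_v E_v ↦ ∑_{i ∈ B} l_i E_i`. -/
def proj (B : Finset V) (x : V → ℝ) : B → ℝ := fun i => x i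

end ResolutionGraph

/-- `f` maps `A` into `B`, and the restriction `A → B` of `f` is a homotopy equivalence. -/
def InducesHomotopyEquiv {X Y : Type*} [TopologicalSpace X] [TopologicalSpace Y] (f : X → Y)
    (A : Set X) (B : Set Y) : Prop :=
  ∃ e : ContinuousMap.HomotopyEquiv A B, ∀ a : A, ((e a : B) : Y) = f a

namespace ResolutionGraph

variable {V : Type*} [Fintype V] [DecidableEq V] (Γ : ResolutionGraph V)

/-! ### The Euler characteristic and its increments -/

/-! The vertices outside `B` are forgotten one at a time, starting from the full vertex set, where
the reduced weight is `chi` itself; supersets of SR-sets are SR-sets, so every stage is of the same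
kind. For forgetting one vertex `v`, three facts make the projection a homotopy equivalence. The
universal cycle minimizes the weight among cycles with given `B`-coefficients (`chiRed_le`), so the
projection maps sublevel sets to sublevel sets. As a function of the `v`-coefficient alone, the
reduced weight falls up to the `v`-coefficient of `x_h(l)` and rises afterwards
(`chiRed_insert_succ_le`, `chiRed_insert_le_succ`), so fibres are intervals. Over each cube of the
reduced sublevel set one integer height serves all vertices at once (`IsSRSet.exists_common_lift`).
This last point exchanges "for every vertex a lift" with "one lift for every vertex", by a minimax
argument peeling leaves of the tree.

The homotopy inverse comes from a continuous selection in the fibres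
(`inducesHomotopyEquiv_of_interval_fibers`). Fibres may shrink in passing from a face to a larger
cube, so no locally constant selection exists over the identity. The selection is therefore made
over `pushToIntegers`, applied coordinatewise, which sends a neighbourhood of each point into the
closed carrier of that point.

The forms `(s_j, ·)` see only `B`-coordinates, so both filtrations are pulled back from the reduced
space. It remains that the reduced ones are stable under the push; for the polyhedral one this uses
integrality of `(s_j, E_v)` and a small `δ`. -/

lemma form_add_right (R : Type*) [CommRing R] (x y z : V → R) :
    Γ.form R x (y + z) = Γ.form R x y + Γ.form R x z := by
  rw [form_comm, form_add_left, form_comm, Γ.form_comm R z]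

lemma form_neg_right (R : Type*) [CommRing R] (x y : V → R) :
    Γ.form R x (-y) = -Γ.form R x y := by
  rw [form_comm, form_neg_left, form_comm]

lemma form_smul_right (R : Type*) [CommRing R] (c : R) (x y : V → R) :
    Γ.form R x (c • y) = c * Γ.form R x y := by
  rw [form_comm, form_smul_left, form_comm]

lemma toRat_add (l m : V → ℤ) : toRat (l + m) = toRat l + toRat m := by
  ext; simp [toRat]

lemma toRat_sub (l m : V → ℤ) : toRat (l - m) = toRat l - toRat m := by
  ext; simp [toRat]

lemma toRat_zero : toRat (0 : V → ℤ) = 0 := by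
  ext; simp [toRat]

lemma toRat_single (u : V) : toRat (Pi.single u 1 : V → ℤ) = E u := by
  ext v
  by_cases h : v = u
  · subst h; simp [toRat, E]
  · simp [toRat, E, h]

lemma form_toRat (x : V → ℚ) (m : V → ℤ) :
    Γ.form ℚ (toRat m) x = ∑ v, (m v : ℚ) * Γ.form ℚ x (E v) := by
  rw [form_comm, form_eq_sum]
  exact Finset.sum_congr rfl fun v _ => mul_comm _ _

lemma form_E_self (v : V) : Γ.form ℚ (E v) (E v) = Γ.euler v := by
  rw [form_E, Finset.sum_eq_single v]
  · simp [E, interMatrix]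
  · intro w _ hw
    simp [E, hw]
  · simp

/-- The Euler characteristic `χ(y) = -(y, y - Z_K) / 2`. -/
noncomputable def euChar (y : V → ℤ) : ℚ := -(Γ.form ℚ (toRat y) (toRat y - Γ.ZK)) / 2

lemma euChar_zero : Γ.euChar 0 = 0 := by
  simp [euChar, toRat_zero, form]

lemma euChar_add (y z : V → ℤ) :
    Γ.euChar (y + z) = Γ.euChar y + Γ.euChar z - Γ.form ℚ (toRat z) (toRat y) := by
  simp only [euChar, toRat_add, sub_eq_add_neg, form_add_left, form_add_right, form_neg_right]
  rw [Γ.form_comm ℚ (toRat y) (toRat z)]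
  ring

lemma euChar_single (u : V) : Γ.euChar (Pi.single u 1) = 1 := by
  rw [euChar, toRat_single, sub_eq_add_neg, form_add_right, form_neg_right,
    Γ.form_comm ℚ (E u) Γ.ZK, form_ZK]
  ring

/-- Weight comparisons rest on this formula: rationality bounds the term `χ(m)`, and the signs of
`(l + s_h, E_v)` control the pairing. -/
lemma chi_add (h : Γ.discGroup) (l m : V → ℤ) :
    Γ.chi h (l + m) = Γ.chi h l + Γ.euChar m - Γ.form ℚ (toRat m) (toRat l + Γ.sh h) := by
  simp only [chi, euChar, toRat_add, sub_eq_add_neg, form_add_left, form_add_right,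
    form_neg_right, form_smul_right]
  rw [Γ.form_comm ℚ (toRat l) (toRat m)]
  ring

lemma chi_add_single (h : Γ.discGroup) (l : V → ℤ) (u : V) :
    Γ.chi h (l + Pi.single u 1) = Γ.chi h l + 1 - Γ.form ℚ (toRat l + Γ.sh h) (E u) := by
  rw [chi_add, euChar_single, toRat_single, form_comm]

lemma sh_zero : Γ.sh 0 = 0 := by
  have h0 : (0 : V → ℚ) ∈ {r : V → ℚ | r ∈ Γ.lipmanCone ∧ Γ.HasClass r 0} :=
    ⟨⟨Γ.dualLattice.zero_mem, fun v => by simp [form]⟩, Γ.dualLattice.zero_mem, rfl⟩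
  refine le_antisymm ((Γ.isLeast_sh 0).2 h0) ?_
  exact Γ.nonneg_of_form_nonpos Finset.univ _ (fun v _ => (Γ.isLeast_sh 0).1.1.2 v)
    fun v hv => absurd (Finset.mem_univ v) hv

lemma chi_zero_eq (l : V → ℤ) : Γ.chi 0 l = Γ.euChar l := by
  rw [chi, euChar, sh_zero]
  simp [sub_eq_add_neg]

lemma euChar_eq_sum (y : V → ℤ) :
    Γ.euChar y = -((∑ v, ∑ w, (y v : ℚ) * interMatrix Γ.graph Γ.euler v w * y w)
      - ∑ v, (y v : ℚ) * (Γ.euler v + 2)) / 2 := by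
  rw [euChar, sub_eq_add_neg, form_add_right, form_neg_right, Γ.form_toRat Γ.ZK]
  simp only [form_ZK, form_E_self]
  simp only [form, toRat]
  ring

/-- The number `e_v` enters `χ(y)` only through `-e_v y_v (y_v - 1) / 2`, which vanishes for `y_v ∈
{0, 1}`. -/
lemma euChar_eq_of_graph_eq (Γ' : ResolutionGraph V) (hg : Γ'.graph = Γ.graph) (y : V → ℤ)
    (hy : ∀ v, Γ'.euler v = Γ.euler v ∨ y v = 0 ∨ y v = 1) : Γ'.euChar y = Γ.euChar y := by
  rw [euChar_eq_sum, euChar_eq_sum, hg]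
  have key : ∀ v w, (interMatrix Γ.graph Γ'.euler v w : ℚ) = interMatrix Γ.graph Γ.euler v w
      + if v = w then (Γ'.euler v - Γ.euler v : ℚ) else 0 := by
    intro v w
    by_cases h : v = w
    · simp [interMatrix, h]
    · simp [interMatrix, h]
  simp only [key, mul_add, add_mul, Finset.sum_add_distrib, mul_ite, ite_mul, mul_zero, zero_mul,
    Finset.sum_ite_eq, Finset.mem_univ, if_true]
  have h2 : ∑ v, (y v : ℚ) * (Γ'.euler v - Γ.euler v : ℚ) * y v
      = ∑ v, (y v : ℚ) * Γ'.euler v - ∑ v, (y v : ℚ) * Γ.euler v := by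
    rw [← Finset.sum_sub_distrib]
    refine Finset.sum_congr rfl fun v _ => ?_
    rcases hy v with h | h | h
    · simp [h]
    · simp [h]
    · simp [h]
  linarith

/-- On cycles that are reduced along `B`, `χ` agrees with that of the rational graph. All estimates
use the SR property in this form. -/
lemma IsSRSet.one_le_euChar {Γ : ResolutionGraph V} {B : Finset V} (hB : Γ.IsSRSet B) {y : V → ℤ}
    (hy : 0 < y) (hyB : ∀ i ∈ B, y i ≤ 1) : 1 ≤ Γ.euChar y := by
  obtain ⟨Γ', hg, he, -, hr⟩ := hB
  rw [← Γ.euChar_eq_of_graph_eq Γ' hg y, ← chi_zero_eq]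
  · exact hr y hy
  · intro v
    by_cases hv : v ∈ B
    · have h1 := hyB v hv
      have h2 := hy.le v
      simp only [Pi.zero_apply] at h2
      right; omega
    · exact Or.inl (he v hv)

lemma IsSRSet.mono {Γ : ResolutionGraph V} {B B' : Finset V} (hB : Γ.IsSRSet B) (h : B ⊆ B') :
    Γ.IsSRSet B' := by
  obtain ⟨Γ', hg, he, hle, hr⟩ := hB
  refine ⟨Γ', hg, fun v hv => he v fun h' => hv (h h'), fun v _ => ?_, hr⟩
  by_cases hv : v ∈ B
  · exact hle v hv
  · exact (he v hv).le

/-- Off-diagonal intersection numbers are nonnegative. This drives both the closure under minima and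
Laufer's algorithm. -/
lemma form_mono {x y : V → ℚ} {v : V} (h : x ≤ y) (hv : x v = y v) :
    Γ.form ℚ x (E v) ≤ Γ.form ℚ y (E v) := by
  rw [form_E, form_E]
  refine Finset.sum_le_sum fun w _ => ?_
  by_cases hw : w = v
  · rw [hw, hv]
  · exact mul_le_mul_of_nonneg_right (h w) (by exact_mod_cast Γ.interMatrix_nonneg hw)

lemma form_toRat_add_mono {x y : V → ℤ} (r : V → ℚ) {v : V} (h : x ≤ y) (hv : x v = y v) :
    Γ.form ℚ (toRat x + r) (E v) ≤ Γ.form ℚ (toRat y + r) (E v) := by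
  refine Γ.form_mono (fun w => ?_) ?_
  · simp only [toRat, Pi.add_apply]
    have : (x w : ℚ) ≤ y w := by exact_mod_cast h w
    linarith
  · simp [toRat, hv]

lemma form_nonneg_of_disjoint {x y : V → ℤ} (hx : 0 ≤ x) (hy : 0 ≤ y) (h : ∀ v, x v = 0 ∨ y v = 0) :
    0 ≤ Γ.form ℚ (toRat x) (toRat y) := by
  refine Finset.sum_nonneg fun v _ => Finset.sum_nonneg fun w _ => ?_
  by_cases hvw : v = w
  · subst hvw
    rcases h v with h | h <;> simp [toRat, h]
  · have h1 : (0 : ℚ) ≤ interMatrix Γ.graph Γ.euler v w := by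
      exact_mod_cast Γ.interMatrix_nonneg hvw
    have h2 : (0 : ℚ) ≤ x v := by exact_mod_cast hx v
    have h3 : (0 : ℚ) ≤ y w := by exact_mod_cast hy w
    exact mul_nonneg (mul_nonneg h2 h1) h3

/-- The weight function is submodular. -/
lemma chi_inf_add_chi_sup_le (h : Γ.discGroup) (x y : V → ℤ) :
    Γ.chi h (x ⊓ y) + Γ.chi h (x ⊔ y) ≤ Γ.chi h x + Γ.chi h y := by
  set m := x ⊓ y
  have hx : x = m + (x - m) := by abel
  have hy : y = m + (y - m) := by abel
  have hs : x ⊔ y = (m + (x - m)) + (y - m) := by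
    ext v
    simp only [m, Pi.sup_apply, Pi.inf_apply, Pi.add_apply, Pi.sub_apply]
    omega
  -- The excesses over the minimum have disjoint supports, and their pairing is exactly the defect
  -- in the inequality.
  have h0 : 0 ≤ Γ.form ℚ (toRat (y - m)) (toRat (x - m)) := by
    refine Γ.form_nonneg_of_disjoint ?_ ?_ fun v => ?_
    · exact sub_nonneg.2 inf_le_right
    · exact sub_nonneg.2 inf_le_left
    · simp only [m, Pi.inf_apply, Pi.sub_apply]
      omega
  have h1 : Γ.chi h (x ⊔ y) = Γ.chi h (m + (x - m)) + Γ.euChar (y - m)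
      - Γ.form ℚ (toRat (y - m)) (toRat (m + (x - m)) + Γ.sh h) := by
    rw [hs, chi_add]
  have h2 : Γ.chi h y = Γ.chi h m + Γ.euChar (y - m)
      - Γ.form ℚ (toRat (y - m)) (toRat m + Γ.sh h) := by
    conv_lhs => rw [hy, chi_add]
  rw [← hx] at h1
  have h3 : Γ.form ℚ (toRat (y - m)) (toRat x + Γ.sh h)
      = Γ.form ℚ (toRat (y - m)) (toRat m + Γ.sh h)
        + Γ.form ℚ (toRat (y - m)) (toRat (x - m)) := by
    rw [← form_add_right]
    congr 1
    conv_lhs => rw [hx, toRat_add]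
    abel
  linarith

end ResolutionGraph

namespace ResolutionGraph

variable {V : Type*} [Fintype V] [DecidableEq V] (Γ : ResolutionGraph V)

/-! ### Universal cycles -/

section UniversalCycles

variable {B : Finset V} {h : Γ.discGroup}

lemma xh_apply (l : B → ℤ) (i : B) : Γ.xh B h l i = l i :=
  (Γ.isLeast_xh B h l).1.1 i

lemma form_xh (l : B → ℤ) {v : V} (hv : v ∉ B) :
    Γ.form ℚ (toRat (Γ.xh B h l) + Γ.sh h) (E v) ≤ 0 :=
  (Γ.isLeast_xh B h l).1.2 v hv

/-- At each `v` the inequality is inherited from whichever of `x`, `z` attains the minimum there, so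
`z` has to satisfy it only where it lies strictly below `x`. -/
lemma inf_mem_xhSet {l : B → ℤ} {x z : V → ℤ} (hx : x ∈ Γ.xhSet B h l) (hz : ∀ i : B, l i ≤ z i)
    (hv : ∀ v ∉ B, x v ≤ z v ∨ Γ.form ℚ (toRat z + Γ.sh h) (E v) ≤ 0) :
    x ⊓ z ∈ Γ.xhSet B h l := by
  refine ⟨fun i => ?_, fun v hvB => ?_⟩
  · have := hx.1 i
    have := hz i
    simp only [Pi.inf_apply]
    omega
  · by_cases hle : x v ≤ z v
    · exact (Γ.form_toRat_add_mono _ inf_le_left (by simpa using hle)).trans (hx.2 v hvB)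
    · refine (Γ.form_toRat_add_mono _ inf_le_right ?_).trans ((hv v hvB).resolve_left hle)
      simpa using (not_le.1 hle).le

lemma xh_le_of_le {l : B → ℤ} {z : V → ℤ} (hz : ∀ i : B, l i ≤ z i)
    (hv : ∀ v ∉ B, Γ.xh B h l v ≤ z v ∨ Γ.form ℚ (toRat z + Γ.sh h) (E v) ≤ 0) :
    Γ.xh B h l ≤ z :=
  ((Γ.isLeast_xh B h l).2 (Γ.inf_mem_xhSet (Γ.isLeast_xh B h l).1 hz hv)).trans inf_le_right

lemma xh_mono {l l' : B → ℤ} (hl : l ≤ l') : Γ.xh B h l ≤ Γ.xh B h l' :=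
  Γ.xh_le_of_le (fun i => by rw [xh_apply]; exact hl i) fun _ hv => Or.inr (Γ.form_xh l' hv)

/-- Universal cycles of effective cycles are effective, by minimality of `s_h`. -/
lemma xh_nonneg {l : B → ℤ} (hl : 0 ≤ l) : 0 ≤ Γ.xh B h l := by
  set x := Γ.xh B h l
  obtain ⟨⟨hs1, hs2⟩, hs3⟩ := (Γ.isLeast_sh h).1
  -- `min(x, 0) + s_h` lies in the Lipman cone with class `h`, hence dominates `s_h`.
  have hform : ∀ v, Γ.form ℚ (toRat (x ⊓ 0) + Γ.sh h) (E v) ≤ 0 := by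
    intro v
    by_cases hv : v ∉ B ∧ x v ≤ 0
    · exact (Γ.form_toRat_add_mono _ inf_le_left (by simpa using hv.2)).trans (Γ.form_xh l hv.1)
    · have h0 : 0 ≤ x v := by
        by_cases hvB : v ∈ B
        · have h1 : x v = l ⟨v, hvB⟩ := Γ.xh_apply l ⟨v, hvB⟩
          rw [h1]
          exact hl ⟨v, hvB⟩
        · exact (not_le.1 fun h' => hv ⟨hvB, h'⟩).le
      refine (Γ.form_toRat_add_mono _ inf_le_right (by simpa using h0)).trans ?_
      rw [toRat_zero, zero_add]
      exact hs2 v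
  have hmem : toRat (x ⊓ 0) + Γ.sh h ∈ Γ.dualLattice :=
    Γ.dualLattice.add_mem (Γ.toRat_mem_dualLattice _) hs1
  have hcl : Γ.HasClass (toRat (x ⊓ 0) + Γ.sh h) h := by
    obtain ⟨hr, hh⟩ := hs3
    refine ⟨hmem, Eq.trans ?_ hh⟩
    rw [QuotientAddGroup.eq, AddSubgroup.mem_addSubgroupOf]
    exact ⟨-(x ⊓ 0), by ext v; simp [toRat]⟩
  have h1 := (Γ.isLeast_sh h).2 ⟨⟨hmem, hform⟩, hcl⟩
  intro v
  have h2 := h1 v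
  simp only [toRat, Pi.add_apply, Pi.inf_apply, Pi.zero_apply] at h2
  have h3 : (0 : ℚ) ≤ ((x v ⊓ 0 : ℤ) : ℚ) := by linarith
  have h4 : 0 ≤ x v ⊓ 0 := by exact_mod_cast h3
  exact le_inf_iff.1 h4 |>.1

/-- Laufer's algorithm: the weight does not increase along the way up to the universal cycle. -/
lemma chiRed_le_of_le_xh {l : B → ℤ} {z : V → ℤ} (hz : ∀ i : B, z i = l i)
    (hle : z ≤ Γ.xh B h l) : Γ.chiRed B h l ≤ Γ.chi h z := by
  obtain ⟨N, hN⟩ : ∃ N : ℕ, ∑ v, (Γ.xh B h l v - z v) ≤ N :=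
    ⟨(∑ v, (Γ.xh B h l v - z v)).toNat, Int.self_le_toNat _⟩
  induction N generalizing z with
  | zero =>
    have h1 : ∀ v ∈ Finset.univ, 0 ≤ Γ.xh B h l v - z v := fun v _ => sub_nonneg.2 (hle v)
    have h2 := (Finset.sum_eq_zero_iff_of_nonneg h1).1
      (le_antisymm (by simpa using hN) (Finset.sum_nonneg h1))
    have h3 : z = Γ.xh B h l := by
      ext v
      have := h2 v (Finset.mem_univ v)
      omega
    rw [h3, chiRed]
  | succ N ih =>
    by_cases hmem : z ∈ Γ.xhSet B h l
    · rw [le_antisymm hle ((Γ.isLeast_xh B h l).2 hmem), chiRed]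
    · obtain ⟨v, hvB, hv⟩ : ∃ v, v ∉ B ∧ 0 < Γ.form ℚ (toRat z + Γ.sh h) (E v) := by
        by_contra! hcon
        exact hmem ⟨hz, hcon⟩
      -- With equal coefficients at `v`, monotonicity would give `(z + s_h, E_v) ≤ 0`; so adding
      -- `E_v` stays below the universal cycle.
      have hlt : z v < Γ.xh B h l v := by
        refine lt_of_le_of_ne (hle v) fun heq => hv.not_ge ?_
        exact (Γ.form_toRat_add_mono _ hle heq).trans (Γ.form_xh l hvB)
      -- The positive number `(z + s_h, E_v)` is an integer, hence at least `1`, which compensates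
      -- `χ(E_v) = 1`.
      obtain ⟨m, hm⟩ := Γ.dualLattice.add_mem (Γ.toRat_mem_dualLattice z)
        (Γ.isLeast_sh h).1.1.1 (Pi.single v 1)
      rw [toRat_single] at hm
      have hm1 : 1 ≤ m := by
        rw [hm] at hv
        have : 0 < m := by exact_mod_cast hv
        omega
      have hm2 : (1 : ℚ) ≤ m := by exact_mod_cast hm1
      have hstep : Γ.chi h (z + Pi.single v 1) ≤ Γ.chi h z := by
        rw [chi_add_single, hm]
        linarith
      refine le_trans (ih (z := z + Pi.single v 1) (fun i => ?_) (fun w => ?_) ?_) hstep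
      · have : (i : V) ≠ v := fun h' => hvB (h' ▸ i.2)
        simp [this, hz i]
      · by_cases hw : w = v
        · subst hw; simpa using hlt
        · simpa [hw] using hle w
      · have : ∑ w, (Γ.xh B h l w - (z + Pi.single v 1 : V → ℤ) w)
            = ∑ w, (Γ.xh B h l w - z w) - 1 := by
          simp [Finset.sum_add_distrib, Finset.sum_sub_distrib]
          ring
        rw [this]
        push_cast at hN
        linarith

/-- The universal cycle minimizes the weight among all cycles with given `B`-coefficients. -/
lemma chiRed_le (hB : Γ.IsSRSet B) {l : B → ℤ} {z : V → ℤ} (hz : ∀ i : B, z i = l i) :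
    Γ.chiRed B h l ≤ Γ.chi h z := by
  set x := Γ.xh B h l
  have h1 : Γ.chi h x ≤ Γ.chi h (x ⊓ z) :=
    Γ.chiRed_le_of_le_xh (fun i => by simp [x, xh_apply, hz]) inf_le_left
  -- By submodularity it suffices that neither the meet nor the join with `z` has smaller weight
  -- than `x`: Laufer's algorithm gives the meet, rationality the join.
  have h2 := Γ.chi_inf_add_chi_sup_le h x z
  have h3 : Γ.chi h x ≤ Γ.chi h (x ⊔ z) := by
    set y := x ⊔ z - x
    have hy : 0 ≤ y := sub_nonneg.2 le_sup_left
    have hyB : ∀ v ∈ B, y v = 0 := by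
      intro v hv
      have h4 := Γ.xh_apply (h := h) l ⟨v, hv⟩
      have h5 := hz ⟨v, hv⟩
      simp only at h4 h5
      simp [y, x, h4, h5]
    have hsup : x ⊔ z = x + y := by simp [y]
    have hform : Γ.form ℚ (toRat y) (toRat x + Γ.sh h) ≤ 0 := by
      rw [form_toRat]
      refine Finset.sum_nonpos fun v _ => ?_
      by_cases hv : v ∈ B
      · simp [hyB v hv]
      · exact mul_nonpos_of_nonneg_of_nonpos (by exact_mod_cast hy v) (Γ.form_xh l hv)
    have hX : 0 ≤ Γ.euChar y := by
      rcases hy.eq_or_lt with h0 | h0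
      · rw [← h0, euChar_zero]
      · linarith [hB.one_le_euChar h0 fun i hi => by rw [hyB i hi]; norm_num]
    rw [hsup, chi_add]
    linarith
  rw [chiRed]
  linarith

/-- If every removal of an `E_v` from the support increased `χ`, integrality would give `(y, E_v) -
e_v - 2 ≥ 0` there. Weighted by `y_v` these numbers sum to `-2 χ(y)`, contradicting positivity. -/
lemma exists_euChar_sub_single_le {y : V → ℤ} (hy : 0 ≤ y) (hX : 0 < Γ.euChar y) :
    ∃ u, 1 ≤ y u ∧ Γ.euChar (y - Pi.single u 1) ≤ Γ.euChar y := by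
  by_contra! hcon
  have hX' : Γ.euChar y = -(∑ v, (y v : ℚ) * (Γ.form ℚ (toRat y) (E v) - Γ.euler v - 2)) / 2 := by
    rw [euChar, sub_eq_add_neg, form_add_right, form_neg_right, form_toRat, Γ.form_toRat Γ.ZK,
      ← sub_eq_add_neg, ← Finset.sum_sub_distrib]
    simp only [form_ZK, form_E_self]
    congr 2
    exact Finset.sum_congr rfl fun v _ => by ring
  have : 0 ≤ ∑ v, (y v : ℚ) * (Γ.form ℚ (toRat y) (E v) - Γ.euler v - 2) := by
    refine Finset.sum_nonneg fun v _ => ?_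
    by_cases hv : 1 ≤ y v
    · have h1 := hcon v hv
      have h2 := Γ.euChar_add (y - Pi.single v 1) (Pi.single v 1)
      rw [sub_add_cancel, euChar_single, toRat_single, toRat_sub, toRat_single, form_comm,
        sub_eq_add_neg (toRat y), form_add_left, form_neg_left, form_E_self] at h2
      obtain ⟨m, hm⟩ := Γ.toRat_mem_dualLattice y (Pi.single v 1)
      rw [toRat_single] at hm
      rw [hm] at h2 ⊢
      have h3 : (1 : ℚ) < m - Γ.euler v := by linarith
      have h4 : 1 < m - Γ.euler v := by exact_mod_cast h3
      have h5 : 0 ≤ m - Γ.euler v - 2 := by omega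
      have h6 : (0 : ℚ) ≤ m - Γ.euler v - 2 := by exact_mod_cast h5
      exact mul_nonneg (by exact_mod_cast hy v) h6
    · have h0 : y v = 0 := le_antisymm (by omega) (hy v)
      simp [h0]
  linarith

/-- Above a universal cycle, a given coefficient can be lowered by one without increasing the
weight. -/
lemma exists_chi_le_sub_one (hB : Γ.IsSRSet B) {x y : V → ℤ} {v : V}
    (hx : ∀ w ∉ B, Γ.form ℚ (toRat x + Γ.sh h) (E w) ≤ 0) (hy : 0 ≤ y) (hyB : ∀ i ∈ B, y i = 0)
    (hv : 1 ≤ y v) : ∃ z : V → ℤ, (∀ i ∈ B, z i = 0) ∧ z v = y v - 1 ∧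
      Γ.chi h (x + z) ≤ Γ.chi h (x + y) := by
  obtain ⟨N, hN⟩ : ∃ N : ℕ, ∑ w, y w ≤ N := ⟨(∑ w, y w).toNat, Int.self_le_toNat _⟩
  induction N generalizing y with
  | zero =>
    have := Finset.single_le_sum (f := y) (fun w _ => hy w) (Finset.mem_univ v)
    push_cast at hN
    omega
  | succ N ih =>
    have hy0 : 0 < y := by
      refine lt_of_le_of_ne hy fun h0 => ?_
      rw [← h0] at hv
      simp at hv
    have hX := hB.one_le_euChar hy0 fun i hi => by rw [hyB i hi]; norm_num
    -- Base elements are peeled off until `v` itself is hit. Since `u ∉ B`, the pairing of `E_u`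
    -- with `x + s_h` is nonpositive, so peeling does not increase `chi` either.
    obtain ⟨u, hu, hle⟩ := Γ.exists_euChar_sub_single_le hy (by linarith)
    have huB : u ∉ B := fun h' => by rw [hyB u h'] at hu; norm_num at hu
    have hchi : Γ.chi h (x + (y - Pi.single u 1)) ≤ Γ.chi h (x + y) := by
      rw [chi_add, chi_add, toRat_sub, toRat_single, sub_eq_add_neg (toRat y), form_add_left,
        form_neg_left, Γ.form_comm ℚ (E u)]
      linarith [hx u huB]
    have hB' : ∀ i ∈ B, (y - Pi.single u 1 : V → ℤ) i = 0 := by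
      intro i hi
      have : i ≠ u := fun h' => huB (h' ▸ hi)
      simp [this, hyB i hi]
    by_cases huv : u = v
    · subst huv
      exact ⟨_, hB', by simp, hchi⟩
    · have hvu : (y - Pi.single u 1 : V → ℤ) v = y v := by simp [Ne.symm huv]
      obtain ⟨z, hz1, hz2, hz3⟩ := ih (y := y - Pi.single u 1) (fun w => by
          by_cases hw : w = u
          · subst hw; simpa using hu
          · simpa [hw] using hy w) hB' (by rw [hvu]; exact hv) (by
          simp only [Pi.sub_apply, Finset.sum_sub_distrib, Finset.sum_pi_single',
            Finset.mem_univ, if_true]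
          push_cast at hN
          linarith)
      exact ⟨z, hz1, by rw [hz2, hvu], hz3.trans hchi⟩

/-- The universal cycle `z` of `l₁` must violate the condition at `v`: otherwise it would compete
for `x_h(l)` and its `v`-coefficient could not be smaller. Hence `z + E_v`, a competitor for `l₂`,
has no larger weight. -/
lemma chiRed_insert_succ_le {v : V} (hB : Γ.IsSRSet (insert v B)) (hvB : v ∉ B) {l : B → ℤ}
    {l₁ l₂ : ↥(insert v B) → ℤ} (hl₁ : ∀ i : B, l₁ ⟨i, Finset.mem_insert_of_mem i.2⟩ = l i)
    (hl₂ : ∀ i : B, l₂ ⟨i, Finset.mem_insert_of_mem i.2⟩ = l i)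
    (hl : l₂ ⟨v, Finset.mem_insert_self v B⟩ = l₁ ⟨v, Finset.mem_insert_self v B⟩ + 1)
    (ht : l₁ ⟨v, Finset.mem_insert_self v B⟩ < Γ.xh B h l v) :
    Γ.chiRed (insert v B) h l₂ ≤ Γ.chiRed (insert v B) h l₁ := by
  set z := Γ.xh (insert v B) h l₁ with hz
  have hzB : ∀ i : B, z i = l i := fun i => by
    rw [← hl₁ i, ← Γ.xh_apply (h := h) l₁]
  have hzv : z v = l₁ ⟨v, Finset.mem_insert_self v B⟩ := by
    rw [← Γ.xh_apply (h := h) l₁]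
  have hpos : 0 < Γ.form ℚ (toRat z + Γ.sh h) (E v) := by
    by_contra! hcon
    have hmem : z ∈ Γ.xhSet B h l := by
      refine ⟨hzB, fun w hw => ?_⟩
      by_cases hwv : w = v
      · rw [hwv]; exact hcon
      · exact Γ.form_xh l₁ (by simp [hwv, hw])
    have hle : Γ.xh B h l v ≤ z v := (Γ.isLeast_xh B h l).2 hmem v
    omega
  obtain ⟨m, hm⟩ := Γ.dualLattice.add_mem (Γ.toRat_mem_dualLattice z)
    (Γ.isLeast_sh h).1.1.1 (Pi.single v 1)
  rw [toRat_single] at hm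
  have hm1 : (1 : ℚ) ≤ m := by
    rw [hm] at hpos
    have : 0 < m := by exact_mod_cast hpos
    exact_mod_cast (by omega : 1 ≤ m)
  have hstep : Γ.chi h (z + Pi.single v 1) ≤ Γ.chi h z := by
    rw [chi_add_single, hm]
    linarith
  refine (Γ.chiRed_le hB ?_).trans hstep
  rintro ⟨i, hi⟩
  rcases Finset.mem_insert.1 hi with rfl | hi'
  · simp [hl, hzv]
  · have : i ≠ v := fun h' => hvB (h' ▸ hi')
    simp [this, hzB ⟨i, hi'⟩, hl₂ ⟨i, hi'⟩]

/-- Here the universal cycle of `l₂` lies above `x_h(l)`, with strictly larger `v`-coefficient.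
Lowering that coefficient by one as in `exists_chi_le_sub_one` gives a competitor for `l₁`. -/
lemma chiRed_insert_le_succ {v : V} (hB : Γ.IsSRSet B) (hvB : v ∉ B) {l : B → ℤ}
    {l₁ l₂ : ↥(insert v B) → ℤ} (hl₁ : ∀ i : B, l₁ ⟨i, Finset.mem_insert_of_mem i.2⟩ = l i)
    (hl₂ : ∀ i : B, l₂ ⟨i, Finset.mem_insert_of_mem i.2⟩ = l i)
    (hl : l₂ ⟨v, Finset.mem_insert_self v B⟩ = l₁ ⟨v, Finset.mem_insert_self v B⟩ + 1)
    (ht : Γ.xh B h l v ≤ l₁ ⟨v, Finset.mem_insert_self v B⟩) :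
    Γ.chiRed (insert v B) h l₁ ≤ Γ.chiRed (insert v B) h l₂ := by
  set x := Γ.xh B h l with hx
  set z := Γ.xh (insert v B) h l₂ with hz
  have hzB : ∀ i : B, z i = l i := fun i => by
    rw [← hl₂ i, ← Γ.xh_apply (h := h) l₂]
  have hxB : ∀ i : B, x i = l i := fun i => Γ.xh_apply l i
  have hzv : z v = l₂ ⟨v, Finset.mem_insert_self v B⟩ := by
    rw [← Γ.xh_apply (h := h) l₂]
  have hxv : x v ≤ l₁ ⟨v, Finset.mem_insert_self v B⟩ := ht
  have hxz : x ≤ z := by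
    refine Γ.xh_le_of_le (fun i => (hzB i).ge) fun w hw => ?_
    by_cases hwv : w = v
    · left; rw [hwv, hzv, hl, ← hx]; omega
    · exact Or.inr (Γ.form_xh l₂ (by simp [hwv, hw]))
  obtain ⟨y, hy1, hy2, hy3⟩ := Γ.exists_chi_le_sub_one (h := h) (x := x) (y := z - x) (v := v) hB
    (fun w hw => Γ.form_xh l hw) (sub_nonneg.2 hxz)
    (fun i hi => by simp [hzB ⟨i, hi⟩, hxB ⟨i, hi⟩]) (by simp only [Pi.sub_apply]; omega)
  rw [add_sub_cancel] at hy3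
  refine (Γ.chiRed_le (hB.mono (Finset.subset_insert v B)) ?_).trans hy3
  rintro ⟨i, hi⟩
  rcases Finset.mem_insert.1 hi with rfl | hi'
  · simp only [Pi.add_apply, hy2, Pi.sub_apply]; omega
  · simp [hy1 i hi', hxB ⟨i, hi'⟩, hl₁ ⟨i, hi'⟩]

end UniversalCycles

end ResolutionGraph

/-! ### Simultaneous minimization over a forest -/

section Minimax

variable {α : Type*} [DecidableEq α]

/-- A minimax theorem for set functions `F` in which, on every nonempty `W`, some element has a
marginal of constant sign. One player chooses subsets outside `B`, the other subsets of `B`. -/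
theorem exists_forall_le_of_forall_exists_le (B : Finset α) (F : Finset α → ℚ) (n : ℚ)
    (hF : ∀ W C : Finset α, W.Nonempty → Disjoint W C → ∃ u ∈ W,
      (∀ T ⊆ W, u ∉ T → F (insert u (C ∪ T)) ≤ F (C ∪ T)) ∨
      (∀ T ⊆ W, u ∉ T → F (C ∪ T) ≤ F (insert u (C ∪ T))))
    (W C : Finset α) (hWC : Disjoint W C)
    (hex : ∀ J ⊆ W ∩ B, ∃ A ⊆ W \ B, F (C ∪ (J ∪ A)) ≤ n) :
    ∃ A ⊆ W \ B, ∀ J ⊆ W ∩ B, F (C ∪ (J ∪ A)) ≤ n := by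
  obtain ⟨k, hk⟩ : ∃ k, W.card = k := ⟨_, rfl⟩
  induction k generalizing W C with
  | zero =>
    rw [Finset.card_eq_zero] at hk
    subst hk
    obtain ⟨A, hA, h⟩ := hex ∅ (by simp)
    refine ⟨A, hA, fun J hJ => ?_⟩
    have : J = ∅ := by simpa using hJ
    rwa [this]
  | succ k ih =>
    have hne : W.Nonempty := Finset.card_pos.1 (by omega)
    -- The constant sign settles the move at `u` in advance: the player owning `u` has a dominant
    -- choice. So `u` is either discarded from `W` or moved to `C`, the set of elements already
    -- chosen.
    obtain ⟨u, hu, hsign⟩ := hF W C hne hWC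
    have huC : u ∉ C := Finset.disjoint_left.1 hWC hu
    have hcard : (W.erase u).card = k := by rw [Finset.card_erase_of_mem hu, hk]; rfl
    have hd1 : Disjoint (W.erase u) C := hWC.mono_left (Finset.erase_subset u W)
    have hd2 : Disjoint (W.erase u) (insert u C) := by
      rw [Finset.disjoint_insert_right]
      exact ⟨Finset.notMem_erase u W, hd1⟩
    have e₁ : ∀ J A : Finset α, insert u C ∪ (J ∪ A) = insert u (C ∪ (J ∪ A)) := by
      clear * -; grind
    have e₂ : ∀ J A : Finset α, insert u C ∪ (J ∪ A) = C ∪ (insert u J ∪ A) := by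
      clear * -; grind
    have e₃ : ∀ J A : Finset α, insert u C ∪ (J ∪ A) = C ∪ (J ∪ insert u A) := by
      clear * -; grind
    have s₁ : ∀ J ⊆ W.erase u ∩ B, J ⊆ W ∩ B := by clear * -; grind
    have s₂ : ∀ A ⊆ W.erase u \ B, A ⊆ W \ B := by clear * -; grind
    have s₃ : ∀ A ⊆ W \ B, A.erase u ⊆ W.erase u \ B := by clear * -; grind
    have s₄ : ∀ J ⊆ W ∩ B, J.erase u ⊆ W.erase u ∩ B := by clear * -; grind
    have s₅ : ∀ J ⊆ W ∩ B, ∀ A ⊆ W \ B, J ∪ A ⊆ W := by clear * -; grind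
    -- For `u ∈ B` the opponent maximizes: a nonpositive marginal makes omitting `u` the worst case,
    -- a nonnegative one makes including it the worst case. For `u ∉ B` the roles are reversed.
    by_cases huB : u ∈ B
    · have huA : ∀ A ⊆ W \ B, u ∉ A := by clear * - huB; grind
      rcases hsign with hle | hle
      · obtain ⟨A, hA, h⟩ := ih (W.erase u) C hd1 (fun J hJ => by
          obtain ⟨A, hA, h⟩ := hex J (s₁ J hJ)
          exact ⟨A, by rw [← Finset.erase_eq_of_notMem (huA A hA)]; exact s₃ A hA, h⟩) hcard
        refine ⟨A, s₂ A hA, fun J hJ => ?_⟩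
        have h1 := h (J.erase u) (s₄ J hJ)
        by_cases huJ : u ∈ J
        · have h2 := hle (J.erase u ∪ A) (s₅ _ (s₁ _ (s₄ J hJ)) A (s₂ A hA))
            (by simp [huA A (s₂ A hA)])
          rw [← e₁, e₂, Finset.insert_erase huJ] at h2
          exact h2.trans h1
        · rwa [Finset.erase_eq_of_notMem huJ] at h1
      · obtain ⟨A, hA, h⟩ := ih (W.erase u) (insert u C) hd2 (fun J hJ => by
          obtain ⟨A, hA, h⟩ := hex (insert u J)
            (Finset.insert_subset (Finset.mem_inter.2 ⟨hu, huB⟩) (s₁ J hJ))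
          exact ⟨A, by rw [← Finset.erase_eq_of_notMem (huA A hA)]; exact s₃ A hA,
            by rwa [e₂]⟩) hcard
        refine ⟨A, s₂ A hA, fun J hJ => ?_⟩
        have h1 := h (J.erase u) (s₄ J hJ)
        by_cases huJ : u ∈ J
        · rwa [e₂, Finset.insert_erase huJ] at h1
        · rw [Finset.erase_eq_of_notMem huJ, e₁] at h1
          exact (hle (J ∪ A) (s₅ J hJ A (s₂ A hA)) (by simp [huJ, huA A (s₂ A hA)])).trans h1
    · have huJ : ∀ J ⊆ W ∩ B, u ∉ J := by clear * - huB; grind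
      have s₆ : ∀ J ⊆ W ∩ B, J ⊆ W.erase u ∩ B := fun J hJ => by
        rw [← Finset.erase_eq_of_notMem (huJ J hJ)]; exact s₄ J hJ
      rcases hsign with hle | hle
      · obtain ⟨A, hA, h⟩ := ih (W.erase u) (insert u C) hd2 (fun J hJ => by
          obtain ⟨A, hA, h⟩ := hex J (s₁ J hJ)
          refine ⟨A.erase u, s₃ A hA, ?_⟩
          by_cases huA : u ∈ A
          · rwa [e₃, Finset.insert_erase huA]
          · rw [Finset.erase_eq_of_notMem huA, e₁]
            exact (hle (J ∪ A) (s₅ J (s₁ J hJ) A hA)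
              (by simp [huA, huJ J (s₁ J hJ)])).trans h) hcard
        refine ⟨insert u A, Finset.insert_subset (Finset.mem_sdiff.2 ⟨hu, huB⟩) (s₂ A hA),
          fun J hJ => ?_⟩
        rw [← e₃]
        exact h J (s₆ J hJ)
      · obtain ⟨A, hA, h⟩ := ih (W.erase u) C hd1 (fun J hJ => by
          obtain ⟨A, hA, h⟩ := hex J (s₁ J hJ)
          refine ⟨A.erase u, s₃ A hA, ?_⟩
          by_cases huA : u ∈ A
          · have h2 := hle (J ∪ A.erase u) (s₅ J (s₁ J hJ) _ (s₂ _ (s₃ A hA)))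
              (by simp [huJ J (s₁ J hJ)])
            rw [← e₁, e₃, Finset.insert_erase huA] at h2
            exact h2.trans h
          · rwa [Finset.erase_eq_of_notMem huA]) hcard
        exact ⟨A, s₂ A hA, fun J hJ => h J (s₆ J hJ)⟩

end Minimax

/-- Every nonempty set of vertices of a tree contains a vertex with at most one neighbour in it. -/
lemma SimpleGraph.IsTree.exists_mem_subsingleton_neighbors {V : Type*} {G : SimpleGraph V}
    (hG : G.IsTree) {W : Finset V} (hW : W.Nonempty) :
    ∃ u ∈ W, ∀ p ∈ W, ∀ q ∈ W, G.Adj p u → G.Adj q u → p = q := by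
  obtain ⟨r⟩ := hG.connected.nonempty
  obtain ⟨u, hu, hmax⟩ := W.exists_max_image (G.dist r) hW
  refine ⟨u, hu, fun p hp q hq hpu hqu => ?_⟩
  -- As `u` is farthest from the root within `W`, each neighbour in `W` is the penultimate vertex of
  -- the unique path from `r` to `u`.
  have hdist : ∀ p ∈ W, G.Adj p u → G.dist r u = G.dist r p + 1 := by
    intro p hp hpu
    have h1 := hmax p hp
    rcases hG.dist_eq_dist_add_one_of_adj r hpu with h | h
    · omega
    · exact h
  have hwalk : ∀ p ∈ W, ∀ hpu : G.Adj p u, ∃ w : G.Walk r p, (w.concat hpu).IsPath := by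
    intro p hp hpu
    obtain ⟨w, hw⟩ := hG.connected.exists_walk_length_eq_dist r p
    refine ⟨w, SimpleGraph.Walk.isPath_of_length_eq_dist _ ?_⟩
    rw [SimpleGraph.Walk.length_concat, hw, hdist p hp hpu]
  obtain ⟨w₁, h₁⟩ := hwalk p hp hpu
  obtain ⟨w₂, h₂⟩ := hwalk q hq hqu
  have h3 := (hG.existsUnique_path r u).unique h₁ h₂
  simpa using congrArg SimpleGraph.Walk.penultimate h3

namespace ResolutionGraph

variable {V : Type*} [Fintype V] [DecidableEq V] (Γ : ResolutionGraph V)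

/-! ### Reduced cycles and common lifts over cubes. -/

lemma sumE_insert {u : V} {T : Finset V} (hu : u ∉ T) :
    sumE (insert u T) = sumE T + Pi.single u 1 := by
  ext v
  by_cases hv : v = u
  · subst hv; simp [sumE, hu]
  · simp [sumE, hv]

lemma sumE_union {S T : Finset V} (h : Disjoint S T) : sumE (S ∪ T) = sumE S + sumE T := by
  ext v
  by_cases hS : v ∈ S
  · simp [sumE, hS, Finset.disjoint_left.1 h hS]
  · simp [sumE, hS]

lemma form_toRat_sumE (T : Finset V) (u : V) :
    Γ.form ℚ (toRat (sumE T)) (E u) = ∑ w ∈ T, (interMatrix Γ.graph Γ.euler w u : ℚ) := by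
  rw [form_E]
  simp [toRat, sumE]

lemma form_toRat_sumE_nonneg {T : Finset V} {u : V} (hu : u ∉ T) :
    0 ≤ Γ.form ℚ (toRat (sumE T)) (E u) := by
  rw [form_toRat_sumE]
  refine Finset.sum_nonneg fun w hw => ?_
  exact_mod_cast Γ.interMatrix_nonneg fun h : w = u => hu (h ▸ hw)

lemma form_toRat_sumE_le_one {T : Finset V} {u : V} (hu : u ∉ T)
    (hT : ∀ p ∈ T, ∀ q ∈ T, Γ.graph.Adj p u → Γ.graph.Adj q u → p = q) :
    Γ.form ℚ (toRat (sumE T)) (E u) ≤ 1 := by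
  rw [form_toRat_sumE]
  have h0 : ∀ w ∈ T, ¬ Γ.graph.Adj w u → (interMatrix Γ.graph Γ.euler w u : ℚ) = 0 := by
    intro w hw hadj
    have : w ≠ u := fun h => hu (h ▸ hw)
    simp [interMatrix, this, hadj]
  by_cases hex : ∃ p ∈ T, Γ.graph.Adj p u
  · obtain ⟨p, hp, hpu⟩ := hex
    rw [Finset.sum_eq_single p]
    · have : p ≠ u := fun h => hu (h ▸ hp)
      simp [interMatrix, this, hpu]
    · intro w hw hwp
      exact h0 w hw fun hadj => hwp (hT w hw p hp hadj hpu)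
    · exact fun h => absurd hp h
  · push Not at hex
    rw [Finset.sum_eq_zero fun w hw => h0 w hw (hex w hw)]
    norm_num

/-- The weight of `x + E_T` as a function of `T`: its marginals at leaves have constant sign. -/
lemma exists_marginal_constant_sign (h : Γ.discGroup) (x : V → ℤ) (W C : Finset V)
    (hW : W.Nonempty) (hWC : Disjoint W C) : ∃ u ∈ W,
      (∀ T ⊆ W, u ∉ T → Γ.chi h (x + sumE (insert u (C ∪ T))) ≤ Γ.chi h (x + sumE (C ∪ T))) ∨
      (∀ T ⊆ W, u ∉ T → Γ.chi h (x + sumE (C ∪ T)) ≤ Γ.chi h (x + sumE (insert u (C ∪ T)))) := by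
  obtain ⟨u, hu, hleaf⟩ := Γ.isTree.exists_mem_subsingleton_neighbors hW
  obtain ⟨m, hm⟩ := Γ.dualLattice.add_mem (Γ.toRat_mem_dualLattice (x + sumE C))
    (Γ.isLeast_sh h).1.1.1 (Pi.single u 1)
  rw [toRat_single] at hm
  have key : ∀ T ⊆ W, u ∉ T → Γ.chi h (x + sumE (insert u (C ∪ T)))
      = Γ.chi h (x + sumE (C ∪ T)) + (1 - m - Γ.form ℚ (toRat (sumE T)) (E u)) := by
    intro T hT huT
    have huCT : u ∉ C ∪ T := by
      rw [Finset.mem_union]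
      exact not_or.2 ⟨Finset.disjoint_left.1 hWC hu, huT⟩
    have hsum : toRat (x + sumE (C ∪ T)) + Γ.sh h
        = (toRat (x + sumE C) + Γ.sh h) + toRat (sumE T) := by
      rw [sumE_union (hWC.symm.mono_right hT), ← add_assoc, toRat_add]
      abel
    rw [sumE_insert huCT, ← add_assoc, chi_add_single, hsum, form_add_left, hm]
    ring
  refine ⟨u, hu, ?_⟩
  -- The marginal is `1 - m - (E_T, E_u)` with `m` an integer independent of `T`, and `0 ≤ (E_T,
  -- E_u) ≤ 1` because `u` has at most one neighbour in `W`. The cases `m ≥ 1` and `m ≤ 0` thus fix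
  -- the sign.
  rcases le_or_gt 1 m with h1 | h1
  · left
    intro T hT huT
    have h2 := Γ.form_toRat_sumE_nonneg huT
    have h3 : (1 : ℚ) ≤ m := by exact_mod_cast h1
    rw [key T hT huT]
    linarith
  · right
    intro T hT huT
    have h2 := Γ.form_toRat_sumE_le_one huT
      fun p hp q hq => hleaf p (hT hp) q (hT hq)
    have h3 : (m : ℚ) ≤ 0 := by exact_mod_cast (by omega : m ≤ 0)
    rw [key T hT huT]
    linarith

/-- In the (almost) rational situation, the Euler characteristic does not increase on replacing
a cycle by its reduced support. -/
lemma IsSRSet.euChar_sumE_le {Γ : ResolutionGraph V} {B : Finset V} (hB : Γ.IsSRSet B)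
    {y : V → ℤ} (hy : 0 ≤ y) (hyB : ∀ i ∈ B, y i ≤ 1) {T : Finset V}
    (hT : ∀ v, v ∈ T ↔ y v ≠ 0) : Γ.euChar (sumE T) ≤ Γ.euChar y := by
  induction hk : T.card using Nat.strong_induction_on generalizing y T with
  | _ k ih =>
  rcases T.eq_empty_or_nonempty with rfl | ⟨t, ht⟩
  · have h1 : y = 0 := by
      ext v
      by_contra hv
      simpa using (hT v).2 hv
    have h2 : sumE (∅ : Finset V) = 0 := by ext; simp [sumE]
    rw [h1, h2]
  -- A maximal nonempty `S ⊆ T` with `χ(E_S) ≤ 1` has no edge to `T \ S`, since adding an adjacent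
  -- vertex would keep `χ ≤ 1`. So `y` splits orthogonally: on `S`, `χ(E_S) ≤ 1 ≤ χ(y₁)`, and
  -- induction treats the rest.
  · obtain ⟨S, hS, hmax⟩ := (T.powerset.filter fun S : Finset V => S.Nonempty ∧
      Γ.euChar (sumE S) ≤ 1).exists_max_image Finset.card ⟨{t}, by
        have h1 : sumE ({t} : Finset V) = Pi.single t 1 := by
          ext v; simp [sumE, Pi.single_apply]
        simp [ht, h1, euChar_single]⟩
    simp only [Finset.mem_filter, Finset.mem_powerset] at hS hmax
    obtain ⟨hST, hSne, hS1⟩ := hS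
    have horth : ∀ u ∈ T \ S, Γ.form ℚ (toRat (sumE S)) (E u) = 0 := by
      intro u hu
      obtain ⟨huT, huS⟩ := Finset.mem_sdiff.1 hu
      have h1 := Γ.form_toRat_sumE_nonneg huS
      refine le_antisymm ?_ h1
      by_contra! hpos
      obtain ⟨m, hm⟩ := Γ.toRat_mem_dualLattice (sumE S) (Pi.single u 1)
      rw [toRat_single] at hm
      rw [hm] at hpos
      have h2 : 0 < m := by exact_mod_cast hpos
      have h3 : (1 : ℚ) ≤ m := by exact_mod_cast h2
      have h4 := hmax (insert u S) ⟨Finset.insert_subset huT hST, Finset.insert_nonempty u S, by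
        rw [sumE_insert huS, euChar_add, euChar_single, toRat_single, form_comm, hm]
        linarith⟩
      rw [Finset.card_insert_of_notMem huS] at h4
      omega
    have hadj : ∀ v ∈ S, ∀ w ∈ T \ S, interMatrix Γ.graph Γ.euler v w = 0 := by
      intro v hv w hw
      have h1 := horth w hw
      have hwS := (Finset.mem_sdiff.1 hw).2
      rw [form_toRat_sumE, Finset.sum_eq_zero_iff_of_nonneg] at h1
      · exact_mod_cast h1 v hv
      · intro u hu
        exact_mod_cast Γ.interMatrix_nonneg fun h : u = w => hwS (h ▸ hu)
    let y₁ : V → ℤ := fun v => if v ∈ S then y v else 0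
    let y₂ : V → ℤ := fun v => if v ∈ S then 0 else y v
    have hy₁₂ : y = y₁ + y₂ := by
      ext v
      by_cases hv : v ∈ S <;> simp [y₁, y₂, hv]
    have hdis : ∀ a b : V → ℤ, (∀ v, v ∉ S → a v = 0) → (∀ v, v ∉ T \ S → b v = 0) →
        Γ.form ℚ (toRat b) (toRat a) = 0 := by
      intro a b ha hb
      rw [form_comm]
      refine Finset.sum_eq_zero fun v _ => Finset.sum_eq_zero fun w _ => ?_
      by_cases hv : v ∈ S
      · by_cases hw : w ∈ T \ S
        · simp [hadj v hv w hw]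
        · simp [toRat, hb w hw]
      · simp [toRat, ha v hv]
    have e1 : Γ.euChar y = Γ.euChar y₁ + Γ.euChar y₂ := by
      rw [hy₁₂, euChar_add, hdis y₁ y₂, sub_zero]
      · intro v hv; simp [y₁, hv]
      · intro v hv
        by_cases hvS : v ∈ S
        · simp [y₂, hvS]
        · have : v ∉ T := fun h => hv (Finset.mem_sdiff.2 ⟨h, hvS⟩)
          rw [hT, not_not] at this
          simp [y₂, hvS, this]
    have e2 : Γ.euChar (sumE T) = Γ.euChar (sumE S) + Γ.euChar (sumE (T \ S)) := by
      conv_lhs => rw [← Finset.union_sdiff_of_subset hST]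
      rw [sumE_union Finset.disjoint_sdiff, euChar_add, hdis (sumE S) (sumE (T \ S)), sub_zero]
      · intro v hv; simp [sumE, hv]
      · intro v hv; simp only [sumE, if_neg hv]
    have i1 : 1 ≤ Γ.euChar y₁ := by
      refine hB.one_le_euChar (lt_of_le_of_ne (fun v => ?_) fun h0 => ?_) fun i hi => ?_
      · by_cases hv : v ∈ S
        · simpa [y₁, hv] using hy v
        · simp [y₁, hv]
      · obtain ⟨v, hv⟩ := hSne
        have h1 := congrFun h0 v
        simp only [Pi.zero_apply, y₁, if_pos hv] at h1
        exact (hT v).1 (hST hv) h1.symm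
      · by_cases hv : i ∈ S
        · simpa [y₁, hv] using hyB i hi
        · simp [y₁, hv]
    have i2 : Γ.euChar (sumE (T \ S)) ≤ Γ.euChar y₂ := by
      refine ih (T \ S).card ?_ (y := y₂) (fun v => ?_) (fun i hi => ?_) (fun v => ?_) rfl
      · rw [← hk]
        refine Finset.card_lt_card (Finset.sdiff_ssubset hST hSne)
      · by_cases hv : v ∈ S
        · simp [y₂, hv]
        · simpa [y₂, hv] using hy v
      · by_cases hv : i ∈ S
        · simp [y₂, hv]
        · simpa [y₂, hv] using hyB i hi
      · by_cases hv : v ∈ S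
        · simp [y₂, hv]
        · simp [y₂, hv, hT]
    linarith

/-- The fibre over a cube of the reduced lattice: if all vertices of the cube have reduced weight
at most `n`, then they have lifts of weight at most `n` with common coefficients outside `B`. -/
lemma IsSRSet.exists_common_lift {Γ : ResolutionGraph V} {B : Finset V} (hB : Γ.IsSRSet B)
    {h : Γ.discGroup} {l : B → ℤ} (hl : 0 ≤ l) {I : Finset B} {n : ℚ}
    (hn : ∀ J ⊆ I, Γ.chiRed B h (l + sumE J) ≤ n) :
    ∃ a : V → ℤ, 0 ≤ a ∧ ∀ J ⊆ I, ∃ z : V → ℤ, (∀ i : B, z i = (l + sumE J) i) ∧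
      (∀ v ∉ B, z v = a v) ∧ Γ.chi h z ≤ n := by
  set x := Γ.xh B h l with hx
  let I' : Finset V := I.map (Function.Embedding.subtype _)
  have hI'B : I' ⊆ B := fun v hv => by
    obtain ⟨i, -, rfl⟩ := Finset.mem_map.1 hv
    exact i.2
  have hpre : ∀ J' ⊆ I', ∃ J ⊆ I, ∀ i : B, i ∈ J ↔ (i : V) ∈ J' := by
    intro J' hJ'
    refine ⟨I.filter fun i => (i : V) ∈ J', Finset.filter_subset _ _, fun i => ?_⟩
    rw [Finset.mem_filter, and_iff_right_iff_imp]
    intro hi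
    obtain ⟨j, hj, hji⟩ := Finset.mem_map.1 (hJ' hi)
    rwa [← Subtype.ext hji]
  have hWB : (I' ∪ Bᶜ) ∩ B = I' := by
    ext v
    have := @hI'B v
    simp only [Finset.mem_inter, Finset.mem_union, Finset.mem_compl]
    tauto
  have hWB' : (I' ∪ Bᶜ) \ B = Bᶜ := by
    ext v
    have := @hI'B v
    simp only [Finset.mem_sdiff, Finset.mem_union, Finset.mem_compl]
    tauto
  -- The opponent picks a vertex of the cube, that is a subset of `I'`; the other player picks
  -- reduced coefficients outside `B`.
  obtain ⟨A, hA, hAn⟩ := exists_forall_le_of_forall_exists_le B (fun T => Γ.chi h (x + sumE T)) n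
    (Γ.exists_marginal_constant_sign h x) (I' ∪ Bᶜ) ∅ (Finset.disjoint_empty_right _) (by
      intro J' hJ'
      rw [hWB] at hJ'
      obtain ⟨J, hJ, hJJ'⟩ := hpre J' hJ'
      -- The answer to a single vertex is the support of `y`. Truncating `y` to `E_T` does not raise
      -- `χ`, and can only raise the pairing with `x + s_h`, since coefficients drop only outside
      -- `B`, where `(x + s_h, E_v) ≤ 0`.
      set y := Γ.xh B h (l + sumE J) - x with hy_def
      have hy : 0 ≤ y := by
        refine sub_nonneg.2 (Γ.xh_mono fun i => ?_)
        by_cases hi : i ∈ J <;> simp [sumE, hi]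
      have hyB : ∀ i : B, y i = sumE J i := fun i => by
        simp [y, x, xh_apply]
      let T : Finset V := Finset.univ.filter fun v => y v ≠ 0
      have hT : T = J' ∪ T \ B := by
        ext v
        by_cases hv : v ∈ B
        · have h1 := hyB ⟨v, hv⟩
          have h2 := hJJ' ⟨v, hv⟩
          simp only [sumE] at h1 h2
          simp [T, hv, h1, h2]
        · have h1 : v ∉ J' := fun h => hv (hI'B (hJ' h))
          simp [hv, h1]
      refine ⟨T \ B, ?_, ?_⟩
      · rw [hWB']
        intro v hv
        exact Finset.mem_compl.2 (Finset.mem_sdiff.1 hv).2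
      · simp only [Finset.empty_union]
        rw [← hT]
        have h1 : Γ.chi h (x + y) ≤ n := by
          rw [hy_def, add_sub_cancel]
          exact hn J hJ
        have h2 : Γ.euChar (sumE T) ≤ Γ.euChar y := by
          refine hB.euChar_sumE_le hy (fun i hi => ?_) fun v => by simp [T]
          rw [hyB ⟨i, hi⟩]
          simp only [sumE]
          split_ifs <;> norm_num
        have h3 : Γ.form ℚ (toRat y) (toRat x + Γ.sh h)
            ≤ Γ.form ℚ (toRat (sumE T)) (toRat x + Γ.sh h) := by
          rw [form_toRat, form_toRat]
          refine Finset.sum_le_sum fun v _ => ?_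
          by_cases hv : v ∈ B
          · have h4 : sumE T v = y v := by
              have h1 := hyB ⟨v, hv⟩
              simp only [sumE] at h1
              split_ifs at h1 <;> simp [sumE, T, h1]
            rw [h4]
          · refine mul_le_mul_of_nonpos_right ?_ (Γ.form_xh l hv)
            have h4 : sumE T v ≤ y v := by
              have := hy v
              simp only [Pi.zero_apply] at this
              simp only [sumE, T, Finset.mem_filter, Finset.mem_univ, true_and]
              split_ifs <;> omega
            exact_mod_cast h4
        rw [chi_add] at h1 ⊢
        linarith)
  rw [hWB] at hAn
  rw [hWB'] at hA
  refine ⟨x + sumE A, ?_, fun J hJ => ?_⟩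
  · refine add_nonneg (Γ.xh_nonneg hl) fun v => ?_
    by_cases hv : v ∈ A <;> simp [sumE, hv]
  · let J' : Finset V := J.map (Function.Embedding.subtype _)
    refine ⟨x + sumE (J' ∪ A), fun i => ?_, fun v hv => ?_, ?_⟩
    · have hiA : (i : V) ∉ A := fun h => Finset.mem_compl.1 (hA h) i.2
      simp [x, xh_apply, sumE, hiA, J']
    · have hvJ : v ∉ J' := fun h => by
        obtain ⟨i, -, rfl⟩ := Finset.mem_map.1 h
        exact hv i.2
      simp [sumE, hvJ]
    · have h1 := hAn J' (Finset.map_subset_map.2 hJ)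
      simpa using h1

end ResolutionGraph

/-! ### Cubical spaces -/

section Cubical

variable {ι : Type*} [Fintype ι] [DecidableEq ι]

/-- The vertices of the smallest cube containing a point are vertices of any cube containing it. -/
lemma exists_eq_add_sumE {l m : ι → ℤ} {I : Finset ι} {x : ι → ℝ} (hx : x ∈ cube l I)
    (hm : ∀ i, ⌊x i⌋ ≤ m i ∧ m i ≤ ⌈x i⌉) : ∃ J ⊆ I, m = l + sumE J := by
  have h1 : ∀ i, l i ≤ m i ∧ m i ≤ l i + sumE I i := fun i =>
    ⟨(Int.le_floor.2 (hx i).1).trans (hm i).1, (hm i).2.trans (Int.ceil_le.2 (hx i).2)⟩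
  refine ⟨I.filter fun i => m i ≠ l i, Finset.filter_subset _ _, ?_⟩
  ext i
  have := h1 i
  simp only [sumE] at this
  simp only [Pi.add_apply, sumE, Finset.mem_filter]
  by_cases hi : i ∈ I
  · by_cases hmi : m i = l i
    · simp [hmi]
    · simp only [hi, if_true] at this
      simp only [hi, hmi, ne_eq, not_false_eq_true, and_self, if_true]
      omega
  · simp only [hi, if_false] at this
    simp only [hi, false_and, if_false]
    omega

/-- Membership in `S_n(w)` in terms of the vertices of the smallest cube containing a point. -/
lemma mem_sublevel_iff {w : (ι → ℤ) → ℚ} {n : ℤ} {x : ι → ℝ} :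
    x ∈ sublevel w n ↔
      0 ≤ x ∧ ∀ m : ι → ℤ, (∀ i, ⌊x i⌋ ≤ m i ∧ m i ≤ ⌈x i⌉) → w m ≤ n := by
  constructor
  · rintro ⟨l, I, hl, hw, hx⟩
    refine ⟨fun i => ?_, fun m hm => ?_⟩
    · have h1 : (0 : ℝ) ≤ l i := by exact_mod_cast hl i
      exact h1.trans (hx i).1
    · obtain ⟨J, hJ, rfl⟩ := exists_eq_add_sumE hx hm
      exact (Finset.le_sup' (fun J => w (l + sumE J)) (Finset.mem_powerset.2 hJ)).trans hw
  · rintro ⟨hx, hw⟩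
    -- The carrier of `x`: based at the floors, extending in the non-integral directions.
    refine ⟨fun i => ⌊x i⌋, Finset.univ.filter fun i => ⌈x i⌉ ≠ ⌊x i⌋,
      fun i => Int.floor_nonneg.2 (hx i), Finset.sup'_le _ _ fun J hJ => hw _ fun i => ?_,
      fun i => ⟨Int.floor_le _, ?_⟩⟩
    · have h1 := Int.floor_le_ceil (x i)
      by_cases hi : i ∈ J
      · have h2 := Finset.mem_powerset.1 hJ hi
        simp only [Finset.mem_filter, Finset.mem_univ, true_and] at h2
        simp only [Pi.add_apply, sumE, hi, if_true]
        omega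
      · simp only [Pi.add_apply, sumE, hi, if_false]
        omega
    · refine (Int.le_ceil _).trans (Int.cast_le.2 ?_)
      have h1 := Int.ceil_le_floor_add_one (x i)
      simp only [Pi.add_apply, sumE, Finset.mem_filter, Finset.mem_univ, true_and]
      split_ifs with h <;> omega

/-- Points of the closed carrier of a point of `S_n(w)` are in `S_n(w)`. -/
lemma mem_sublevel_of_floor_le {w : (ι → ℤ) → ℚ} {n : ℤ} {x y : ι → ℝ} (hx : x ∈ sublevel w n)
    (hy : ∀ i, (⌊x i⌋ : ℝ) ≤ y i ∧ y i ≤ ⌈x i⌉) : y ∈ sublevel w n := by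
  rw [mem_sublevel_iff] at hx ⊢
  refine ⟨fun i => ?_, fun m hm => hx.2 m fun i =>
    ⟨(Int.le_floor.2 (hy i).1).trans (hm i).1, (hm i).2.trans (Int.ceil_le.2 (hy i).2)⟩⟩
  have h1 : (0 : ℝ) ≤ ⌊x i⌋ := by exact_mod_cast Int.floor_nonneg.2 (hx.1 i)
  exact h1.trans (hy i).1

end Cubical

/-- A continuous map of the line which pushes every unit interval `[m, m + 1]` onto itself,
collapsing neighbourhoods of the end points to these. -/
noncomputable def pushToIntegers (δ u : ℝ) : ℝ := ⌊u⌋ + max 0 (min 1 ((Int.fract u - δ) / δ))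

/-! ### The push of the line towards the integers, and push-stable sets. -/

section Push

variable {δ : ℝ}

/-- The displacement from the identity is a function of the fractional part vanishing at both ends;
`2 * δ < 1` lets the ramp reach `1` in time. -/
lemma continuous_pushToIntegers (h0 : 0 < δ) (h1 : 2 * δ < 1) : Continuous (pushToIntegers δ) := by
  have hc : Continuous ((fun f : ℝ => max 0 (min 1 ((f - δ) / δ)) - f) ∘ Int.fract) := by
    refine ContinuousOn.comp_fract'' (by fun_prop) ?_
    have e0 : (0 - δ) / δ ≤ 0 := div_nonpos_of_nonpos_of_nonneg (by linarith) h0.le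
    have e1 : 1 ≤ (1 - δ) / δ := by rw [le_div_iff₀ h0]; linarith
    rw [min_eq_right (by linarith), max_eq_left e0, min_eq_left e1, max_eq_right zero_le_one]
    norm_num
  have : pushToIntegers δ = fun u => u
      + ((fun f : ℝ => max 0 (min 1 ((f - δ) / δ)) - f) ∘ Int.fract) u := by
    ext u
    simp only [pushToIntegers, Function.comp]
    linarith [Int.self_sub_floor u]
  rw [this]
  exact continuous_id.add hc

lemma floor_le_pushToIntegers (u : ℝ) : (⌊u⌋ : ℝ) ≤ pushToIntegers δ u :=
  le_add_of_nonneg_right (le_max_left _ _)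

lemma pushToIntegers_le_floor_add_one (u : ℝ) : pushToIntegers δ u ≤ ⌊u⌋ + 1 :=
  add_le_add le_rfl (max_le zero_le_one (min_le_left _ _))

lemma pushToIntegers_eq_floor (h0 : 0 < δ) {u : ℝ} (hu : u ≤ ⌊u⌋ + δ) :
    pushToIntegers δ u = ⌊u⌋ := by
  have : (Int.fract u - δ) / δ ≤ 0 :=
    div_nonpos_of_nonpos_of_nonneg (by linarith [Int.self_sub_floor u]) h0.le
  rw [pushToIntegers, max_eq_left ((min_le_right _ _).trans this), add_zero]

lemma pushToIntegers_eq_floor_add_one (h0 : 0 < δ) {u : ℝ} (hu : ⌊u⌋ + 2 * δ ≤ u) :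
    pushToIntegers δ u = ⌊u⌋ + 1 := by
  have : 1 ≤ (Int.fract u - δ) / δ := by
    rw [le_div_iff₀ h0]; linarith [Int.self_sub_floor u]
  rw [pushToIntegers, min_eq_left this, max_eq_right zero_le_one]

lemma pushToIntegers_le_ceil (h0 : 0 < δ) (u : ℝ) : pushToIntegers δ u ≤ ⌈u⌉ := by
  by_cases hu : u ≤ ⌊u⌋ + δ
  · rw [pushToIntegers_eq_floor h0 hu]
    exact_mod_cast Int.floor_le_ceil u
  · refine (pushToIntegers_le_floor_add_one u).trans ?_
    have h1 : (⌊u⌋ : ℝ) < ⌈u⌉ := by linarith [Int.le_ceil u]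
    have h2 : ⌊u⌋ < ⌈u⌉ := by exact_mod_cast h1
    exact_mod_cast h2

/-- Even after rounding down, the push loses at most `2 * δ`: points further than that above their
floor go to the next integer. This serves the polyhedral filtration. -/
lemma sub_le_floor_pushToIntegers (h0 : 0 < δ) (u : ℝ) : u - 2 * δ ≤ ⌊pushToIntegers δ u⌋ := by
  by_cases hu : ⌊u⌋ + 2 * δ ≤ u
  · have h1 : ⌊pushToIntegers δ u⌋ = ⌊u⌋ + 1 := by
      rw [pushToIntegers_eq_floor_add_one h0 hu]
      exact_mod_cast Int.floor_intCast (⌊u⌋ + 1)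
    rw [h1]
    push_cast
    linarith [Int.lt_floor_add_one u]
  · have h1 : (⌊u⌋ : ℝ) ≤ ⌊pushToIntegers δ u⌋ := by
      exact_mod_cast Int.le_floor.2 (floor_le_pushToIntegers u)
    linarith

/-- Near a point, the push takes values in the closed carrier of that point. -/
lemma eventually_pushToIntegers_mem (h0 : 0 < δ) (h1 : 2 * δ < 1) (u₀ : ℝ) :
    ∀ᶠ u in nhds u₀, (⌊u₀⌋ : ℝ) ≤ pushToIntegers δ u ∧ pushToIntegers δ u ≤ ⌈u₀⌉ := by
  -- Points slightly outside the carrier of `u₀` lie in the collapsed zones: the top `1 - 2δ` of the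
  -- unit interval below it, the bottom `δ` of the one above.
  have hl : (⌊u₀⌋ : ℝ) - 1 + 2 * δ < u₀ := by linarith [Int.floor_le u₀]
  have hr : u₀ < (⌈u₀⌉ : ℝ) + δ := by linarith [Int.le_ceil u₀]
  filter_upwards [lt_mem_nhds hl, gt_mem_nhds hr] with u hul hur
  constructor
  · by_cases h : (⌊u₀⌋ : ℝ) ≤ u
    · have : (⌊u₀⌋ : ℝ) ≤ ⌊u⌋ := by exact_mod_cast Int.le_floor.2 h
      exact this.trans (floor_le_pushToIntegers u)
    · have h2 : ⌊u⌋ = ⌊u₀⌋ - 1 := by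
        rw [Int.floor_eq_iff]
        push_cast
        constructor <;> linarith
      rw [pushToIntegers_eq_floor_add_one h0]
      · rw [h2]; push_cast; linarith
      · rw [h2]; push_cast; linarith
  · by_cases h : u ≤ ⌈u₀⌉
    · refine (pushToIntegers_le_ceil h0 u).trans ?_
      exact_mod_cast Int.ceil_le.2 h
    · have h2 : ⌊u⌋ = ⌈u₀⌉ := by
        rw [Int.floor_eq_iff]
        constructor <;> linarith
      rw [pushToIntegers_eq_floor h0]
      · rw [h2]
      · rw [h2]; linarith

/-- A set `P` is push-stable if it contains the segments from its effective points `x` to the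
points obtained by pushing the coordinates of `x`. -/
def PushStable {ι : Type*} (δ : ℝ) (P : Set (ι → ℝ)) : Prop :=
  ∀ x ∈ P, 0 ≤ x → ∀ r ∈ Set.Icc (0 : ℝ) 1,
    (fun i => (1 - r) * x i + r * pushToIntegers δ (x i)) ∈ P

lemma PushStable.comp {ι κ : Type*} {P : Set (ι → ℝ)} (hP : PushStable δ P) (j : ι → κ) :
    PushStable δ ((fun x : κ → ℝ => x ∘ j) ⁻¹' P) :=
  fun x hx h0 r hr => hP (x ∘ j) hx (fun i => h0 (j i)) r hr

lemma PushStable.push_mem {ι : Type*} {P : Set (ι → ℝ)} (hP : PushStable δ P) {x : ι → ℝ}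
    (hx : x ∈ P) (h0 : 0 ≤ x) : (fun i => pushToIntegers δ (x i)) ∈ P := by
  simpa using hP x hx h0 1 (by simp)

/-- The segment from `u` to its push stays in the closed carrier of `u`. -/
lemma segment_push_mem_carrier (h0 : 0 < δ) (u : ℝ) {r : ℝ} (hr : r ∈ Set.Icc (0 : ℝ) 1) :
    (⌊u⌋ : ℝ) ≤ (1 - r) * u + r * pushToIntegers δ u ∧
      (1 - r) * u + r * pushToIntegers δ u ≤ ⌈u⌉ := by
  have h1 := Int.floor_le u
  have h2 := Int.le_ceil u
  have h3 := floor_le_pushToIntegers (δ := δ) u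
  have h4 := pushToIntegers_le_ceil h0 u
  obtain ⟨h5, h6⟩ := hr
  constructor <;> nlinarith

end Push

/-! ### Maps inducing homotopy equivalences -/

section HomotopyEquivalences

variable {X Y Z : Type*} [TopologicalSpace X] [TopologicalSpace Y] [TopologicalSpace Z]

lemma InducesHomotopyEquiv.comp {f : X → Y} {g : Y → Z} {A : Set X} {B : Set Y} {C : Set Z}
    (hg : InducesHomotopyEquiv g B C) (hf : InducesHomotopyEquiv f A B) :
    InducesHomotopyEquiv (g ∘ f) A C := by
  obtain ⟨e, he⟩ := hf
  obtain ⟨e', he'⟩ := hg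
  refine ⟨e.trans e', fun a => ?_⟩
  change ((e' (e a) : C) : Z) = g (f a)
  rw [he', he]

/-- A homotopy between maps to a subspace, given by a map to the ambient space. -/
lemma ContinuousMap.Homotopic.of_ambient {A : Set Y} {f₀ f₁ : C(X, A)} (H : ℝ × X → Y)
    (hH : Continuous H) (hA : ∀ r ∈ Set.Icc (0 : ℝ) 1, ∀ x, H (r, x) ∈ A)
    (h₀ : ∀ x, H (0, x) = f₀ x) (h₁ : ∀ x, H (1, x) = f₁ x) : f₀.Homotopic f₁ :=
  ⟨{ toFun := fun p => ⟨H (p.1, p.2), hA _ p.1.2 _⟩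
     continuous_toFun := by fun_prop
     map_zero_left := fun x => Subtype.ext (h₀ x)
     map_one_left := fun x => Subtype.ext (h₁ x) }⟩

end HomotopyEquivalences

/-! ### Forgetting one coordinate. -/

section Projection

variable {ι κ : Type*} [Fintype ι] [DecidableEq ι] [Fintype κ] [DecidableEq κ]

/-- The vector indexed by `κ ≃ Option ι` with the given coordinates. -/
def glue (e : κ ≃ Option ι) {R : Type*} (x : ι → R) (t : R) : κ → R :=
  fun k => (e k).elim t x

section Glue

variable (e : κ ≃ Option ι) {R : Type*}

lemma glue_none (x : ι → R) (t : R) : glue e x t (e.symm none) = t := by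
  simp [glue]

lemma glue_some (x : ι → R) (t : R) (i : ι) : glue e x t (e.symm (some i)) = x i := by
  simp [glue]

lemma forall_iff_none_some {p : κ → Prop} :
    (∀ k, p k) ↔ p (e.symm none) ∧ ∀ i, p (e.symm (some i)) := by
  rw [← Option.forall (p := fun o => p (e.symm o)), e.symm.forall_congr_right (q := p)]

lemma glue_eta (y : κ → R) : glue e (fun i => y (e.symm (some i))) (y (e.symm none)) = y := by
  funext k
  revert k
  rw [forall_iff_none_some e]
  simp [glue]

lemma Continuous.glue {X : Type*} [TopologicalSpace X] {f : X → ι → ℝ} {g : X → ℝ}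
    (hf : Continuous f) (hg : Continuous g) : Continuous fun x => glue e (f x) (g x) := by
  refine continuous_pi fun k => ?_
  rcases hk : e k with _ | i
  · simpa only [_root_.glue, hk, Option.elim] using hg
  · simpa only [_root_.glue, hk, Option.elim] using continuous_pi_iff.1 hf i

end Glue

/-- The projection forgetting one coordinate induces a homotopy equivalence of cubical spaces if
the fibres over the cubes are nonempty intervals. -/
theorem inducesHomotopyEquiv_of_interval_fibers (e : κ ≃ Option ι) {w' : (κ → ℤ) → ℚ}
    {w : (ι → ℤ) → ℚ} {n : ℤ} {δ : ℝ} (h0 : 0 < δ) (h1 : 2 * δ < 1) {P : Set (ι → ℝ)}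
    (hP : PushStable δ P)
    (hle : ∀ l : κ → ℤ, 0 ≤ l → w (fun i => l (e.symm (some i))) ≤ w' l)
    (hconv : ∀ l : ι → ℤ, 0 ≤ l → ∀ t₁ t t₂ : ℤ, 0 ≤ t₁ → t₁ ≤ t → t ≤ t₂ →
      w' (glue e l t₁) ≤ n → w' (glue e l t₂) ≤ n → w' (glue e l t) ≤ n)
    (hne : ∀ x ∈ sublevel w n, ∃ t : ℤ, 0 ≤ t ∧
      ∀ m : ι → ℤ, (∀ i, ⌊x i⌋ ≤ m i ∧ m i ≤ ⌈x i⌉) → w' (glue e m t) ≤ n) :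
    InducesHomotopyEquiv (fun (y : κ → ℝ) i => y (e.symm (some i)))
      (sublevel w' n ∩ (fun (y : κ → ℝ) i => y (e.symm (some i))) ⁻¹' P)
      (sublevel w n ∩ P) := by
  set f : (κ → ℝ) → ι → ℝ := fun y i => y (e.symm (some i)) with hf
  have hfc : Continuous f := by fun_prop
  let q : (ι → ℝ) → ι → ℝ := fun x i => pushToIntegers δ (x i)
  have hqc : Continuous q :=
    continuous_pi fun i => (continuous_pushToIntegers h0 h1).comp (continuous_apply i)
  have hmap : ∀ y ∈ sublevel w' n, f y ∈ sublevel w n := by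
    intro y hy
    rw [mem_sublevel_iff] at hy ⊢
    refine ⟨fun i => hy.1 _, fun m hm => ?_⟩
    have h2 := hy.2 (glue e m ⌊y (e.symm none)⌋) (by
      rw [forall_iff_none_some e]
      simp only [glue_none, glue_some]
      exact ⟨⟨le_rfl, Int.floor_le_ceil _⟩, hm⟩)
    refine le_trans ?_ h2
    have h3 := hle (glue e m ⌊y (e.symm none)⌋) (by
      intro k
      revert k
      rw [forall_iff_none_some e]
      simp only [glue_none, glue_some, Pi.zero_apply]
      exact ⟨Int.floor_nonneg.2 (hy.1 _), fun i => (Int.floor_nonneg.2 (hy.1 _)).trans (hm i).1⟩)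
    simpa only [glue_some] using h3
  -- Carrier vertices over intermediate `t` have last coordinate between `⌊t₁⌋` and `⌈t₂⌉`, both
  -- admissible, so quasi-convexity along the fibre applies.
  have hfib : ∀ x : ι → ℝ, Convex ℝ {t : ℝ | glue e x t ∈ sublevel w' n} := by
    intro x
    refine Set.OrdConnected.convex ⟨fun t₁ ht₁ t₂ ht₂ t ht => ?_⟩
    simp only [Set.mem_ofPred_eq, mem_sublevel_iff] at ht₁ ht₂ ⊢
    have hx0 : ∀ i, 0 ≤ x i := fun i => by simpa [glue_some] using ht₁.1 (e.symm (some i))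
    have ht0 : 0 ≤ t₁ := by simpa [glue_none] using ht₁.1 (e.symm none)
    refine ⟨?_, fun m hm => ?_⟩
    · intro k
      revert k
      rw [forall_iff_none_some e]
      simp only [glue_none, glue_some, Pi.zero_apply]
      exact ⟨ht0.trans ht.1, hx0⟩
    · rw [forall_iff_none_some e] at hm
      simp only [glue_none, glue_some] at hm
      rw [← glue_eta e m]
      refine hconv _ (fun i => (Int.floor_nonneg.2 (hx0 i)).trans (hm.2 i).1) ⌊t₁⌋ _ ⌈t₂⌉
        (Int.floor_nonneg.2 ht0) ((Int.floor_mono ht.1).trans hm.1.1)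
        (hm.1.2.trans (Int.ceil_mono ht.2)) (ht₁.2 _ ?_) (ht₂.2 _ ?_)
      · rw [forall_iff_none_some e]
        simp only [glue_none, glue_some]
        exact ⟨⟨le_rfl, Int.floor_le_ceil _⟩, hm.2⟩
      · rw [forall_iff_none_some e]
        simp only [glue_none, glue_some]
        exact ⟨⟨Int.floor_le_ceil _, le_rfl⟩, hm.2⟩
  -- The common height `t` for the carrier of `x₀` remains valid at `q x` for `x` near `x₀`, because
  -- `q x` lies in that closed carrier. Convexity then glues these local constants to a continuous
  -- `ψ`.
  have hloc : ∀ x₀ : ↥(sublevel w n ∩ P), ∃ c : ℝ, ∀ᶠ x : ↥(sublevel w n ∩ P) in nhds x₀,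
      c ∈ {t : ℝ | glue e (q x) t ∈ sublevel w' n} := by
    rintro ⟨x₀, hx₀, hx₀P⟩
    obtain ⟨t, ht0, ht⟩ := hne x₀ hx₀
    have hmem : glue e x₀ (t : ℝ) ∈ sublevel w' n := by
      rw [mem_sublevel_iff]
      refine ⟨?_, fun m hm => ?_⟩
      · intro k
        revert k
        rw [forall_iff_none_some e]
        simp only [glue_none, glue_some, Pi.zero_apply]
        exact ⟨by exact_mod_cast ht0, (mem_sublevel_iff.1 hx₀).1⟩
      · rw [forall_iff_none_some e] at hm
        simp only [glue_none, glue_some, Int.floor_intCast, Int.ceil_intCast] at hm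
        rw [← glue_eta e m, le_antisymm hm.1.2 hm.1.1]
        exact ht _ hm.2
    refine ⟨t, ?_⟩
    have hev : ∀ᶠ x in nhds x₀, ∀ i, (⌊x₀ i⌋ : ℝ) ≤ q x i ∧ q x i ≤ ⌈x₀ i⌉ :=
      Filter.eventually_all.2 fun i =>
        (continuous_apply i).continuousAt.eventually (eventually_pushToIntegers_mem h0 h1 (x₀ i))
    filter_upwards [continuous_subtype_val.continuousAt.eventually hev] with x hx
    refine mem_sublevel_of_floor_le hmem ?_
    rw [forall_iff_none_some e]
    simp only [glue_none, glue_some]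
    exact ⟨by simp, hx⟩
  obtain ⟨ψ, hψ⟩ := exists_continuous_forall_mem_convex_of_local_const
    (fun x : ↥(sublevel w n ∩ P) => hfib (q x)) hloc
  have hfg : ∀ (x : ι → ℝ) (t : ℝ), f (glue e x t) = x := fun x t => by
    ext i; simp [hf, glue_some]
  have hpos : ∀ x ∈ sublevel w n, 0 ≤ x := fun x hx => (mem_sublevel_iff.1 hx).1
  let F : C(↥(sublevel w' n ∩ f ⁻¹' P), ↥(sublevel w n ∩ P)) :=
    ⟨fun y => ⟨f y, hmap _ y.2.1, y.2.2⟩, by fun_prop⟩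
  have hψc : Continuous ψ := ψ.continuous
  have hFc : Continuous F := F.continuous
  -- A section only up to homotopy: `g x` lies over `q x`.
  let g : C(↥(sublevel w n ∩ P), ↥(sublevel w' n ∩ f ⁻¹' P)) :=
    ⟨fun x => ⟨glue e (q x) (ψ x), hψ x, by
      rw [Set.mem_preimage, hfg]
      exact hP.push_mem x.2.2 (hpos _ x.2.1)⟩,
      (Continuous.glue e (hqc.comp continuous_subtype_val) hψc).subtype_mk _⟩
  have hmid : ∀ y : ↥(sublevel w' n ∩ f ⁻¹' P), ∀ r ∈ Set.Icc (0 : ℝ) 1,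
      glue e (fun i => (1 - r) * f y i + r * q (f y) i) ((y : κ → ℝ) (e.symm none))
        ∈ sublevel w' n ∩ f ⁻¹' P := by
    intro y r hr
    refine ⟨mem_sublevel_of_floor_le y.2.1 ?_, ?_⟩
    · rw [forall_iff_none_some e]
      simp only [glue_none, glue_some]
      exact ⟨⟨Int.floor_le _, Int.le_ceil _⟩, fun i => segment_push_mem_carrier h0 _ hr⟩
    · rw [Set.mem_preimage, hfg]
      exact hP _ y.2.2 (hpos _ (hmap _ y.2.1)) r hr
  have hmid1 : ∀ y : ↥(sublevel w' n ∩ f ⁻¹' P),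
      glue e (q (f y)) ((y : κ → ℝ) (e.symm none)) ∈ sublevel w' n ∩ f ⁻¹' P := by
    intro y
    simpa using hmid y 1 (by simp)
  have hτ : Continuous fun y : ↥(sublevel w' n ∩ f ⁻¹' P) => (y : κ → ℝ) (e.symm none) :=
    (continuous_apply _).comp continuous_subtype_val
  have hτ' : Continuous fun p : ℝ × ↥(sublevel w' n ∩ f ⁻¹' P) =>
      (p.2 : κ → ℝ) (e.symm none) := hτ.comp continuous_snd
  let G : C(↥(sublevel w' n ∩ f ⁻¹' P), ↥(sublevel w' n ∩ f ⁻¹' P)) :=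
    ⟨fun y => ⟨glue e (q (f y)) ((y : κ → ℝ) (e.symm none)), hmid1 y⟩,
      (Continuous.glue e (by fun_prop) hτ).subtype_mk _⟩
  refine ⟨⟨F, g, ?_, ?_⟩, fun _ => rfl⟩
  -- The composite `g ∘ F` is reached in two moves: push the base coordinates with the last one
  -- fixed, then slide the last coordinate inside the convex fibre over `q (f y)`.
  · have hG1 : (ContinuousMap.id _).Homotopic G := by
      refine ContinuousMap.Homotopic.of_ambient
        (fun p : ℝ × ↥(sublevel w' n ∩ f ⁻¹' P) =>
          glue e (fun i => (1 - p.1) * f p.2 i + p.1 * q (f p.2) i)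
            ((p.2 : κ → ℝ) (e.symm none)))
        (Continuous.glue e (by fun_prop) hτ') (fun r hr y => hmid y r hr)
        (fun y => ?_) fun y => ?_
      · simp only [sub_zero, one_mul, zero_mul, add_zero, ContinuousMap.id_apply]
        exact glue_eta e _
      · simp only [sub_self, zero_mul, one_mul, zero_add]
        rfl
    have hG2 : G.Homotopic (g.comp F) := by
      refine ContinuousMap.Homotopic.of_ambient
        (fun p : ℝ × ↥(sublevel w' n ∩ f ⁻¹' P) =>
          glue e (q (f p.2)) ((1 - p.1) * (p.2 : κ → ℝ) (e.symm none) + p.1 * ψ (F p.2)))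
        (Continuous.glue e (by fun_prop)
          (((continuous_const.sub continuous_fst).mul hτ').add
            (continuous_fst.mul (hψc.comp (hFc.comp continuous_snd))))) (fun r hr y => ⟨?_, ?_⟩)
        (fun y => ?_) fun y => ?_
      · have := hfib (q (f y)) (hmid1 y).1 (hψ (F y)) (sub_nonneg.2 hr.2) hr.1 (by ring)
        simpa using this
      · rw [Set.mem_preimage, hfg]
        exact hP.push_mem (F y).2.2 (hpos _ (F y).2.1)
      · simp only [sub_zero, one_mul, zero_mul, add_zero]
        rfl
      · simp only [sub_self, zero_mul, one_mul, zero_add]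
        rfl
    exact (hG1.trans hG2).symm
  -- `F ∘ g` is the push `q`, joined to the identity by segments within carriers.
  · refine (ContinuousMap.Homotopic.of_ambient (f₀ := ContinuousMap.id _) (f₁ := F.comp g)
      (fun p : ℝ × ↥(sublevel w n ∩ P) => fun i =>
        (1 - p.1) * (p.2 : ι → ℝ) i + p.1 * q (p.2 : ι → ℝ) i)
      (continuous_pi fun i => ?_) (fun r hr x => ⟨?_, ?_⟩) (fun x => ?_) fun x => ?_).symm
    · have hv : Continuous fun p : ℝ × ↥(sublevel w n ∩ P) => (p.2 : ι → ℝ) :=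
        continuous_subtype_val.comp continuous_snd
      exact ((continuous_const.sub continuous_fst).mul (continuous_pi_iff.1 hv i)).add
        (continuous_fst.mul (continuous_pi_iff.1 (hqc.comp hv) i))
    · exact mem_sublevel_of_floor_le x.2.1 fun i => segment_push_mem_carrier h0 _ hr
    · exact hP _ x.2.2 (hpos _ x.2.1) r hr
    · ext i; simp
    · simp only [sub_self, zero_mul, one_mul, zero_add]
      exact (hfg _ _).symm

end Projection

namespace ResolutionGraph

variable {V : Type*} [Fintype V] [DecidableEq V] (Γ : ResolutionGraph V)

/-! ### The reduction theorem for push-stable subspaces -/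

lemma chiRed_univ (h : Γ.discGroup) (l : V → ℤ) :
    Γ.chiRed Finset.univ h (fun i => l i) = Γ.chi h l := by
  rw [chiRed]
  congr 1
  ext v
  exact Γ.xh_apply (fun i : (Finset.univ : Finset V) => l i) ⟨v, Finset.mem_univ v⟩

/-- Base case of the induction: the projection only relabels coordinates and is a homeomorphism. -/
lemma inducesHomotopyEquiv_proj_univ (h : Γ.discGroup) (n : ℤ)
    (P : Set (↥(Finset.univ : Finset V) → ℝ)) :
    InducesHomotopyEquiv (proj Finset.univ)
      (sublevel (Γ.chi h) n ∩ proj Finset.univ ⁻¹' P)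
      (sublevel (Γ.chiRed Finset.univ h) n ∩ P) := by
  let φ : (V → ℝ) ≃ₜ (↥(Finset.univ : Finset V) → ℝ) :=
    { toFun := proj Finset.univ
      invFun := fun x v => x ⟨v, Finset.mem_univ v⟩
      left_inv := fun _ => rfl
      right_inv := fun _ => rfl
      continuous_toFun := continuous_pi fun i => continuous_apply (i : V)
      continuous_invFun := continuous_pi fun v => continuous_apply _ }
  have key : ∀ x : V → ℝ, x ∈ sublevel (Γ.chi h) n ↔
      φ x ∈ sublevel (Γ.chiRed Finset.univ h) n := by
    intro x
    rw [mem_sublevel_iff, mem_sublevel_iff]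
    refine and_congr ⟨fun hx i => hx i, fun hx v => hx ⟨v, Finset.mem_univ v⟩⟩
      ⟨fun hx m hm => ?_, fun hx m hm => ?_⟩
    · have h1 := hx (fun v => m ⟨v, Finset.mem_univ v⟩) fun v => hm ⟨v, Finset.mem_univ v⟩
      rwa [← chiRed_univ] at h1
    · rw [← chiRed_univ]
      exact hx _ fun i => hm i
  refine ⟨(φ.subtype (p := fun x => x ∈ sublevel (Γ.chi h) n ∩ proj Finset.univ ⁻¹' P)
    (q := fun y => y ∈ sublevel (Γ.chiRed Finset.univ h) n ∩ P)
    fun x => and_congr (key x) Iff.rfl).toHomotopyEquiv, fun _ => rfl⟩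

/-- An integer function which decreases up to some point and increases from there on is
quasi-convex. -/
lemma le_of_unimodal {f : ℤ → ℚ} {t₀ t₁ t t₂ : ℤ} {n : ℚ}
    (hdown : ∀ t, t < t₀ → f (t + 1) ≤ f t) (hup : ∀ t, t₀ ≤ t → f t ≤ f (t + 1))
    (h₁ : t₁ ≤ t) (h₂ : t ≤ t₂) (hn₁ : f t₁ ≤ n) (hn₂ : f t₂ ≤ n) : f t ≤ n := by
  rcases le_total t t₀ with h | h
  · have : ∀ k, t₁ ≤ k → k ≤ t₀ → f k ≤ f t₁ := by
      intro k hk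
      induction k, hk using Int.leInduction with
      | base => exact fun _ => le_rfl
      | succ k hk ih => exact fun hk' => (hdown k (by omega)).trans (ih (by omega))
    exact (this t h₁ h).trans hn₁
  · have : ∀ k, t ≤ k → f t ≤ f k := by
      intro k hk
      induction k, hk using Int.leInduction with
      | base => exact le_rfl
      | succ k hk ih => exact ih.trans (hup k (by omega))
    exact (this t₂ h₂).trans hn₂

/-- Forgetting one vertex outside an SR-set. -/
lemma IsSRSet.inducesHomotopyEquiv_insert {Γ : ResolutionGraph V} {B : Finset V}
    (hB : Γ.IsSRSet B) (h : Γ.discGroup) (n : ℤ) {δ : ℝ} (h0 : 0 < δ) (h1 : 2 * δ < 1)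
    {P : Set (B → ℝ)} (hP : PushStable δ P) {v : V} (hv : v ∉ B) :
    InducesHomotopyEquiv
      (fun (y : ↥(insert v B) → ℝ) (i : B) => y ⟨i, Finset.mem_insert_of_mem i.2⟩)
      (sublevel (Γ.chiRed (insert v B) h) n ∩
        (fun (y : ↥(insert v B) → ℝ) (i : B) => y ⟨i, Finset.mem_insert_of_mem i.2⟩) ⁻¹' P)
      (sublevel (Γ.chiRed B h) n ∩ P) := by
  have hB' : Γ.IsSRSet (insert v B) := hB.mono (Finset.subset_insert v B)
  let e : ↥(insert v B) ≃ Option B := Finset.subtypeInsertEquivOption hv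
  have hsome : ∀ (l : B → ℤ) (t : ℤ) (i : B),
      glue e l t ⟨i, Finset.mem_insert_of_mem i.2⟩ = l i := fun l t i => glue_some e l t i
  have hnone : ∀ (l : B → ℤ) (t : ℤ), glue e l t ⟨v, Finset.mem_insert_self v B⟩ = t :=
    fun l t => glue_none e l t
  refine inducesHomotopyEquiv_of_interval_fibers e h0 h1 hP (fun l _ => ?_)
    (fun l _ t₁ t t₂ _ h₁ h₂ => ?_) (fun x hx => ?_)
  · exact Γ.chiRed_le hB fun i => Γ.xh_apply l ⟨i, Finset.mem_insert_of_mem i.2⟩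
  · refine le_of_unimodal (f := fun t => Γ.chiRed (insert v B) h (glue e l t))
      (t₀ := Γ.xh B h l v) (fun t ht => ?_) (fun t ht => ?_) h₁ h₂
    · exact Γ.chiRed_insert_succ_le hB' hv (hsome l t) (hsome l (t + 1))
        (by rw [hnone, hnone]) (by rwa [hnone])
    · exact Γ.chiRed_insert_le_succ hB hv (hsome l t) (hsome l (t + 1))
        (by rw [hnone, hnone]) (by rwa [hnone])
  · obtain ⟨l, I, hl, hw, hx⟩ := hx
    obtain ⟨a, ha, hlift⟩ := hB.exists_common_lift hl (n := n) fun J hJ =>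
      (Finset.le_sup' (fun J => Γ.chiRed B h (l + sumE J)) (Finset.mem_powerset.2 hJ)).trans hw
    -- Only the `v`-coefficient of the common lift is kept; minimality of universal cycles for
    -- `insert v B` absorbs its other coefficients.
    refine ⟨a v, ha v, fun m hm => ?_⟩
    obtain ⟨J, hJ, rfl⟩ := exists_eq_add_sumE hx hm
    obtain ⟨z, hz, hza, hzn⟩ := hlift J hJ
    refine (Γ.chiRed_le hB' ?_).trans hzn
    rintro ⟨i, hi⟩
    rcases Finset.mem_insert.1 hi with rfl | hi'
    · exact (hza i hv).trans (hnone _ _).symm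
    · exact (hz ⟨i, hi'⟩).trans (hsome _ _ ⟨i, hi'⟩).symm

/-- Induction on the number of vertices outside `B`. Allowing arbitrary push-stable `P` makes the
induction close up, since preimages of `P` under coordinate projections are again push-stable. -/
theorem IsSRSet.inducesHomotopyEquiv_proj {Γ : ResolutionGraph V} {B : Finset V}
    (hB : Γ.IsSRSet B) (h : Γ.discGroup) (n : ℤ) {δ : ℝ} (h0 : 0 < δ) (h1 : 2 * δ < 1)
    {P : Set (B → ℝ)} (hP : PushStable δ P) :
    InducesHomotopyEquiv (proj B) (sublevel (Γ.chi h) n ∩ proj B ⁻¹' P)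
      (sublevel (Γ.chiRed B h) n ∩ P) := by
  induction hk : (Bᶜ).card generalizing B with
  | zero =>
    obtain rfl : B = Finset.univ := by
      rwa [Finset.card_eq_zero, Finset.compl_eq_empty_iff] at hk
    exact Γ.inducesHomotopyEquiv_proj_univ h n P
  | succ k ih =>
    obtain ⟨v, hv⟩ := Finset.card_pos.1 (by omega : 0 < Bᶜ.card)
    have hvB : v ∉ B := Finset.mem_compl.1 hv
    have h2 := ih (hB.mono (Finset.subset_insert v B))
      (hP.comp fun i : B => (⟨i, Finset.mem_insert_of_mem i.2⟩ : ↥(insert v B)))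
      (by rw [Finset.compl_insert, Finset.card_erase_of_mem hv, hk]; rfl)
    exact (hB.inducesHomotopyEquiv_insert h n h0 h1 hP hvB).comp h2

/-! ### The filtrations -/

/-- This is how the support condition enters: the filtrations depend on `B`-coordinates only. -/
lemma form_eq_sum_subtype {B : Finset V} {s : V → ℚ} (hs : ∀ v ∉ B, Γ.form ℚ s (E v) = 0)
    (x : V → ℚ) : Γ.form ℚ s x = ∑ i : B, Γ.form ℚ s (E i) * x i := by
  rw [form_eq_sum, Finset.sum_coe_sort B fun v => Γ.form ℚ s (E v) * x v]
  refine (Finset.sum_subset (Finset.subset_univ B) fun v _ hv => ?_).symm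
  rw [hs v hv, zero_mul]

lemma form_real_eq_sum_subtype {B : Finset V} {s : V → ℚ} (hs : ∀ v ∉ B, Γ.form ℚ s (E v) = 0)
    (x : V → ℝ) :
    Γ.form ℝ (fun v => (s v : ℝ)) x = ∑ i : B, (Γ.form ℚ s (E i) : ℝ) * x i := by
  have h1 : Γ.form ℝ (fun v => (s v : ℝ)) x = ∑ v, (Γ.form ℚ s (E v) : ℝ) * x v := by
    rw [form, Finset.sum_comm]
    refine Finset.sum_congr rfl fun v _ => ?_
    rw [form_E, Rat.cast_sum, Finset.sum_mul]
    push_cast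
    rfl
  rw [h1, Finset.sum_coe_sort B fun v => (Γ.form ℚ s (E v) : ℝ) * x v]
  refine (Finset.sum_subset (Finset.subset_univ B) fun v _ hv => ?_).symm
  rw [hs v hv, Rat.cast_zero, zero_mul]

lemma extendZero_apply {R : Type*} [Zero R] {B : Finset V} (x : B → R) (i : B) :
    extendZero B x i = x i := by
  simp [extendZero]

section Filtrations

variable {B : Finset V} {t : ℕ} {s : Fin t → V → ℚ} (d : Fin t → ℤ)

/-- Each `(s_j, ·)` is nonincreasing in every coefficient, so raising the base of a cube preserves
the condition; the full unit cube at the floors of `y` then serves. -/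
lemma mem_filtRed_of_floor_le (hs : ∀ j, ∀ v ∉ B, Γ.form ℚ (s j) (E v) = 0)
    (hneg : ∀ j v, Γ.form ℚ (s j) (E v) ≤ 0) {x y : B → ℝ} (hx : x ∈ Γ.filtRed B s d)
    (hxy : ∀ i, (⌊x i⌋ : ℝ) ≤ y i) : y ∈ Γ.filtRed B s d := by
  obtain ⟨l, I, hl, hd, hc⟩ := hx
  have hle : ∀ i, l i ≤ ⌊y i⌋ := fun i => (Int.le_floor.2 (hc i).1).trans (Int.le_floor.2 (hxy i))
  refine ⟨fun i => ⌊y i⌋, Finset.univ, fun i => (hl i).trans (hle i), fun j => ?_, fun i => ?_⟩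
  · refine le_trans ?_ (hd j)
    rw [Γ.form_eq_sum_subtype (hs j), Γ.form_eq_sum_subtype (hs j)]
    refine Finset.sum_le_sum fun i _ => mul_le_mul_of_nonpos_left ?_ (hneg j i)
    simp only [toRat, extendZero_apply]
    exact_mod_cast hle i
  · refine ⟨Int.floor_le _, ?_⟩
    simp only [Pi.add_apply, sumE, Finset.mem_univ, if_true]
    push_cast
    exact (Int.lt_floor_add_one _).le

lemma pushStable_filtRed (hs : ∀ j, ∀ v ∉ B, Γ.form ℚ (s j) (E v) = 0)
    (hneg : ∀ j v, Γ.form ℚ (s j) (E v) ≤ 0) {δ : ℝ} (h0 : 0 < δ) :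
    PushStable δ (Γ.filtRed B s d) :=
  fun _ hx _ _ hr => Γ.mem_filtRed_of_floor_le d hs hneg hx
    fun _ => (segment_push_mem_carrier h0 _ hr).1

lemma mem_filt_iff (hs : ∀ j, ∀ v ∉ B, Γ.form ℚ (s j) (E v) = 0)
    (hneg : ∀ j v, Γ.form ℚ (s j) (E v) ≤ 0) {x : V → ℝ} (hx : 0 ≤ x) :
    x ∈ Γ.filt s d ↔ proj B x ∈ Γ.filtRed B s d := by
  constructor
  · rintro ⟨l, I, hl, hd, hc⟩
    refine ⟨fun i => l i, Finset.univ.filter fun i : B => (i : V) ∈ I, fun i => hl i,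
      fun j => ?_, fun i => ?_⟩
    · refine le_trans (le_of_eq ?_) (hd j)
      rw [Γ.form_eq_sum_subtype (hs j), Γ.form_eq_sum_subtype (hs j)]
      simp only [toRat, extendZero_apply]
    · simpa [sumE, proj] using hc i
  · rintro ⟨l, I, hl, hd, hc⟩
    refine ⟨fun v => ⌊x v⌋, Finset.univ, fun v => Int.floor_nonneg.2 (hx v), fun j => ?_,
      fun v => ⟨Int.floor_le _, ?_⟩⟩
    · refine le_trans ?_ (hd j)
      rw [Γ.form_eq_sum_subtype (hs j), Γ.form_eq_sum_subtype (hs j)]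
      refine Finset.sum_le_sum fun i _ => mul_le_mul_of_nonpos_left ?_ (hneg j i)
      simp only [toRat, extendZero_apply]
      exact_mod_cast Int.le_floor.2 (hc i).1
    · simp only [Pi.add_apply, sumE, Finset.mem_univ, if_true]
      push_cast
      exact (Int.lt_floor_add_one _).le

lemma mem_halfFilt_iff (hs : ∀ j, ∀ v ∉ B, Γ.form ℚ (s j) (E v) = 0) {x : V → ℝ} (hx : 0 ≤ x) :
    x ∈ Γ.halfFilt s d ↔ proj B x ∈ Γ.halfFiltRed B s d := by
  have h1 : (0 : B → ℝ) ≤ proj B x := fun i => hx i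
  simp only [halfFilt, halfFiltRed, Set.mem_ofPred_eq, hx, h1, true_and]
  refine forall_congr' fun j => ?_
  rw [Γ.form_real_eq_sum_subtype (hs j), Γ.form_real_eq_sum_subtype (hs j)]
  simp only [extendZero_apply, proj]

/-- At the floors of the pushed coordinates `(s_j, ·)` exceeds its value at `x` by less than `1`, by
the choice of `δ`. It is an integer there, so it is still at most `-d_j`. Returning from the floors
to the push only lowers it, and the segment follows by linearity. -/
lemma pushStable_halfFiltRed (hs : ∀ j, ∀ v ∉ B, Γ.form ℚ (s j) (E v) = 0)
    (hneg : ∀ j v, Γ.form ℚ (s j) (E v) ≤ 0) (hint : ∀ j v, ∃ m : ℤ, Γ.form ℚ (s j) (E v) = m)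
    {δ : ℝ} (h0 : 0 < δ)
    (hδ : ∀ j, 2 * δ * ∑ i : B, -(Γ.form ℚ (s j) (E i) : ℝ) < 1) :
    PushStable δ (Γ.halfFiltRed B s d) := by
  rintro x ⟨-, hd⟩ hx r hr
  refine ⟨fun i => ?_, fun j => ?_⟩
  · have h1 : (0 : ℝ) ≤ ⌊x i⌋ := by exact_mod_cast Int.floor_nonneg.2 (hx i)
    exact h1.trans (segment_push_mem_carrier h0 _ hr).1
  · have hd := hd j
    have hδ := hδ j
    have hneg : ∀ i : B, (Γ.form ℚ (s j) (E i) : ℝ) ≤ 0 := fun i => by exact_mod_cast hneg j i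
    rw [Γ.form_real_eq_sum_subtype (hs j)] at hd ⊢
    simp only [extendZero_apply] at hd ⊢
    choose a ha using hint j
    have ha' : ∀ v, (Γ.form ℚ (s j) (E v) : ℝ) = a v := fun v => by rw [ha]; simp
    simp only [ha'] at hd hδ hneg ⊢
    have h1 : ∑ i : B, (a i : ℝ) * ⌊pushToIntegers δ (x i)⌋
        ≤ ∑ i : B, ((a i : ℝ) * x i + 2 * δ * -(a i : ℝ)) := by
      refine Finset.sum_le_sum fun i _ => ?_
      have := mul_le_mul_of_nonpos_left (sub_le_floor_pushToIntegers h0 (x i)) (hneg i)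
      linarith
    rw [Finset.sum_add_distrib, ← Finset.mul_sum] at h1
    have h2 : ∑ i : B, (a i : ℝ) * ⌊pushToIntegers δ (x i)⌋ < -d j + 1 := by linarith
    have h3 : ∑ i : B, a i * ⌊pushToIntegers δ (x i)⌋ < -d j + 1 := by exact_mod_cast h2
    have h4 : ∑ i : B, (a i : ℝ) * ⌊pushToIntegers δ (x i)⌋ ≤ -d j := by
      exact_mod_cast Int.lt_add_one_iff.1 h3
    have h5 : ∑ i : B, (a i : ℝ) * pushToIntegers δ (x i) ≤ -d j :=
      (Finset.sum_le_sum fun i _ =>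
        mul_le_mul_of_nonpos_left (Int.floor_le _) (hneg i)).trans h4
    have h6 : ∑ i : B, (a i : ℝ) * ((1 - r) * x i + r * pushToIntegers δ (x i))
        = (1 - r) * ∑ i : B, (a i : ℝ) * x i
          + r * ∑ i : B, (a i : ℝ) * pushToIntegers δ (x i) := by
      rw [Finset.mul_sum, Finset.mul_sum, ← Finset.sum_add_distrib]
      exact Finset.sum_congr rfl fun i _ => by ring
    rw [h6]
    have h7 := mul_le_mul_of_nonneg_left hd (sub_nonneg.2 hr.2)
    have h8 := mul_le_mul_of_nonneg_left h5 hr.1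
    linarith

end Filtrations

end ResolutionGraph

theorem mainTheorem4 {V : Type*} [Fintype V] [DecidableEq V] (Γ : ResolutionGraph V)
    (B : Finset V) (hB : Γ.IsSRSet B) (h : Γ.discGroup)
    {t : ℕ} (s : Fin t → V → ℚ)
    (hs : ∀ j, s j ∈ Γ.lipmanCone \ {0})
    (hsupp : ∀ j, Γ.supp (s j) ⊆ (B : Set V))
    (n : ℤ) (d : Fin t → ℤ) :
    InducesHomotopyEquiv (ResolutionGraph.proj B)
      (sublevel (Γ.chi h) n ∩ Γ.filt s d)
      (sublevel (Γ.chiRed B h) n ∩ Γ.filtRed B s d) ∧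
    InducesHomotopyEquiv (ResolutionGraph.proj B)
      (sublevel (Γ.chi h) n ∩ Γ.halfFilt s d)
      (sublevel (Γ.chiRed B h) n ∩ Γ.halfFiltRed B s d) := by
  have hneg : ∀ j v, Γ.form ℚ (s j) (ResolutionGraph.E v) ≤ 0 := fun j v => (hs j).1.2 v
  have hzero : ∀ j, ∀ v ∉ B, Γ.form ℚ (s j) (ResolutionGraph.E v) = 0 := by
    intro j v hv
    refine le_antisymm (hneg j v) (not_lt.1 fun hlt => hv ?_)
    exact_mod_cast hsupp j hlt
  have hint : ∀ j v, ∃ m : ℤ, Γ.form ℚ (s j) (ResolutionGraph.E v) = m := by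
    intro j v
    rw [← ResolutionGraph.toRat_single]
    exact (hs j).1.1 (Pi.single v 1)
  set c : Fin t → ℝ := fun j => ∑ i : B, -(Γ.form ℚ (s j) (ResolutionGraph.E i) : ℝ)
  have hc : ∀ j, 0 ≤ c j := fun j =>
    Finset.sum_nonneg fun i _ => neg_nonneg.2 (by exact_mod_cast hneg j i)
  set C : ℝ := ∑ j, c j
  have hC : ∀ j, c j ≤ C := fun j => Finset.single_le_sum (fun k _ => hc k) (Finset.mem_univ j)
  have hC0 : 0 ≤ C := Finset.sum_nonneg fun j _ => hc j
  -- The summand `1` yields `2 * δ < 1` and `C` yields the bound for every `s_j`.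
  obtain ⟨δ, h0, h1⟩ : ∃ δ : ℝ, 0 < δ ∧ 2 * δ * (1 + C) < 1 := by
    refine ⟨1 / (4 * (1 + C)), by positivity, ?_⟩
    field_simp
    norm_num
  have h2 : 2 * δ < 1 := by nlinarith
  have hδ : ∀ j, 2 * δ * c j < 1 := fun j => by nlinarith [hC j]
  have hpos : ∀ x ∈ sublevel (Γ.chi h) n, 0 ≤ x := fun x hx => (mem_sublevel_iff.1 hx).1
  constructor
  · have he : sublevel (Γ.chi h) n ∩ Γ.filt s d
        = sublevel (Γ.chi h) n ∩ ResolutionGraph.proj B ⁻¹' Γ.filtRed B s d := by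
      ext x
      exact and_congr_right fun hx => Γ.mem_filt_iff d hzero hneg (hpos x hx)
    rw [he]
    exact hB.inducesHomotopyEquiv_proj h n h0 h2 (Γ.pushStable_filtRed d hzero hneg h0)
  · have he : sublevel (Γ.chi h) n ∩ Γ.halfFilt s d
        = sublevel (Γ.chi h) n ∩ ResolutionGraph.proj B ⁻¹' Γ.halfFiltRed B s d := by
      ext x
      exact and_congr_right fun hx => Γ.mem_halfFilt_iff d hzero (hpos x hx)
    rw [he]
    exact hB.inducesHomotopyEquiv_proj h n h0 h2
      (Γ.pushStable_halfFiltRed d hzero hneg hint h0 hδ)
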